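/- **Setting.** Let $\Lambda_{E_8}\subset\mathbb R^8$ be the set of all vectors $(n_1,\dots,n_8)$ and $(n_1+\tfrac12,\dots,n_8+\tfrac12)$ with $n_i\in\mathbb Z$ and $\sum_i n_i$ even. A root is a vector $e\in\Lambda_{E_8}$ with $e\cdot e=2$. Let $\Lambda_{E_8\times E_8}=\Lambda_{E_8}\oplus\Lambda_{E_8}$. An embedding of one $E_8$ is a triple $\{V,a_1,a_3\}$ of vectors of $\mathbb R^8$. An observable embedding $\{V_A,a_{1A},a_{3A}\}$ and a hidden embedding $\{V_B,a_{1B},a_{3B}\}$ are combined to $V=(V_A;V_B)$, $a_i=(a_{iA};a_{iB})$ in $\mathbb R^{16}$. The hidden embedding is *consistent* with the observable one if $3V,\,3a_1,\,3a_3\in\Lambda_{E_8\times E_8}$ and $3V\cdot V,\ 3V\cdot a_i,\ 3a_i\cdot a_j\in\mathbb Z$ for all $i,j\in\{1,3\}$. Two hidden embeddings are *equivalent* if one is obtained from the other by a finite sequence of the following operations: (I) add a vector $\ell\in\Lambda_{E_8}$ to any one of $V_B,a_{1B},a_{3B}$; (II) replace $P$ by $P-(P\cdot e)e$ simultaneously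 for $P=V_B,a_{1B},a_{3B}$, where $e$ is a root. The hidden gauge group $G_H$ of $\{V_B,a_{1B},a_{3B}\}$ is taken up to local isomorphism: it is $K\times U(1)^{8-r}$, where $K$ is the semisimple group, of rank $r$, whose root system consists of the roots $e$ with $e\cdot V_B,\ e\cdot a_{1B},\ e\cdot a_{3B}\in\mathbb Z$. Cases 1 to 5 are 1. $SO(10)\times U(1)^3$; 2. $SU(5)\times SU(2)\times U(1)^3$; 3. $SU(4)\times SU(2)^2\times U(1)^3$; 4. $SU(3)\times SU(2)^2\times U(1)^4$; 5. $SU(2)^2\times U(1)^6$. The six observable embeddings CMM 1, 2, 4, 6, 8, 9 are, written as $3V_A;\ 3a_{1A};\ 3a_{3A}$: - CMM 1: $(-1,-1,0,0,0,2,0,0);\ (1,1,-1,-1,2,0,0,0);\ (0,0,0,0,0,0,2,0)$ - CMM 2: $(-1,-1,0,0,0,2,0,0);\ (1,1,-1,-1,-1,-1,0,0);\ (0,0,0,0,0,0,2,0)$ - CMM 4: $(-1,-1,0,0,0,2,0,0);\ (1,1,-1,-1,-1,0,1,0);\ (0,0,0,0,0,0,2,0)$ - CMM 6: $(-1,-1,0,0,0,2,0,0);\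 (1,1,-1,-1,-1,2,1,0);\ (0,0,0,0,0,1,1,2)$ - CMM 8: $(-1,-1,0,0,0,1,1,0);\ (1,1,-1,-1,-1,1,1,1);\ (0,0,0,0,0,1,2,1)$ - CMM 9: $(-1,-1,0,0,0,1,1,0);\ (1,1,-1,-1,-1,-2,0,1);\ (0,0,0,0,0,0,0,2)$ The tables below list hidden embeddings. Each table belongs to one CMM embedding and has a fixed $3V_B$; an entry is written $3a_{1B};\ 3a_{3B}\ [\text{case of }G_H]$. **Theorem.** (a) The eight tables have 175 entries in total. The entries of each table are pairwise distinct. Every entry is a hidden embedding consistent with the CMM embedding of its table, and has the gauge group $G_H$ stated, which is one of Cases 1 to 4. (b) For each of CMM 1, 2, 4, 6, 8, 9, every consistent hidden embedding whose gauge group is not that of Case 5 is equivalent to an entry of a table belonging to that CMM embedding. (c) The tables can be extended by 17 further entries in total, to 192 entries. Each new entry has the $3V_B$ of its table and integral $3a_{1B}$, $3a_{3B}$, is consistent with the CMM embedding of its table, and has the gauge group of Case 5. The entries of each extended table are pairwise distinct. For each of CMM 1, 2, 4, 6, 8, 9, every consistent hidden embedding is equivalent to an entry of an extended table belonging to that CMM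 embedding. It is not claimed that different entries are inequivalent. **Tables.** CMM 1, $3V_B=(2,1,1,0,0,0,0,0)$: 1. $(-2,0,0,0,0,0,0,0);\ (0,1,-1,0,0,0,0,0)\ [1]$ 2. $(0,2,0,0,0,0,0,0);\ (-1,0,-1,0,0,0,0,0)\ [1]$ 3. $(0,2,0,0,0,0,0,0);\ (1,0,1,0,0,0,0,0)\ [1]$ 4. $(-2,0,0,0,0,0,0,0);\ (0,0,0,2,1,1,1,-1)\ [2]$ 5. $(-2,0,0,0,0,0,0,0);\ (0,0,0,2,1,1,1,1)\ [2]$ 6. $(-1,1,0,1,1,0,0,0);\ (-1,-1,0,0,0,0,0,0)\ [2]$ 7. $(-1,1,0,1,1,0,0,0);\ (0,0,0,1,-1,0,0,0)\ [2]$ 8. $(-1,1,0,1,1,0,0,0);\ (1,1,0,0,0,0,0,0)\ [2]$ 9. $(0,1,1,1,1,0,0,0);\ (0,0,0,1,-1,0,0,0)\ [2]$ 10. $(0,1,1,1,1,0,0,0);\ (0,1,-1,0,0,0,0,0)\ [2]$ 11. $(0,2,0,0,0,0,0,0);\ (0,0,0,2,1,1,1,-1)\ [2]$ 12. $(0,2,0,0,0,0,0,0);\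 (0,0,0,2,1,1,1,1)\ [2]$ 13. $(-2,0,0,0,0,0,0,0);\ (0,0,0,1,1,0,0,0)\ [3]$ 14. $(-1,1,0,1,1,0,0,0);\ (-2,-1,-1,1,1,0,0,0)\ [3]$ 15. $(-1,1,0,1,1,0,0,0);\ (2,1,1,-1,-1,0,0,0)\ [3]$ 16. $(0,1,1,1,1,0,0,0);\ (-2,-1,-1,1,1,0,0,0)\ [3]$ 17. $(0,1,1,1,1,0,0,0);\ (2,1,1,-1,-1,0,0,0)\ [3]$ 18. $(0,2,0,0,0,0,0,0);\ (0,0,0,1,1,0,0,0)\ [3]$ 19. $(-2,0,0,0,0,0,0,0);\ (0,-1,-2,1,1,1,0,0)\ [4]$ 20. $(-1,1,0,1,1,0,0,0);\ (-2,-1,-1,0,-1,1,0,0)\ [4]$ 21. $(-1,1,0,1,1,0,0,0);\ (-2,0,1,-1,-1,1,0,0)\ [4]$ 22. $(-1,1,0,1,1,0,0,0);\ (-2,1,0,0,0,1,1,-1)\ [4]$ 23. $(-1,1,0,1,1,0,0,0);\ (-2,1,0,0,0,1,1,1)\ [4]$ 24. $(-1,1,0,1,1,0,0,0);\ (2,1,1,1,0,1,0,0)\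 [4]$ 25. $(-1,1,0,1,1,0,0,0);\ (2,-1,0,0,0,1,1,1)\ [4]$ 26. $(-1,1,0,1,1,0,0,0);\ (-1,1,1,-1,-1,1,1,-1)\ [4]$ 27. $(0,1,1,1,1,0,0,0);\ (-2,-1,-1,0,-1,1,0,0)\ [4]$ 28. $(0,1,1,1,1,0,0,0);\ (-2,1,0,1,1,1,0,0)\ [4]$ 29. $(0,1,1,1,1,0,0,0);\ (2,0,-1,-1,-1,1,0,0)\ [4]$ 30. $(0,1,1,1,1,0,0,0);\ (2,1,1,1,0,1,0,0)\ [4]$ 31. $(0,1,1,1,1,0,0,0);\ (-1,1,1,-1,-1,1,1,-1)\ [4]$ 32. $(0,2,0,0,0,0,0,0);\ (-2,0,1,1,1,1,0,0)\ [4]$ 33. $(0,2,0,0,0,0,0,0);\ (2,0,-1,1,1,1,0,0)\ [4]$ CMM 2, $3V_B=(2,1,1,0,0,0,0,0)$: 1. $(-2,0,-1,1,0,0,0,0);\ (-1,0,-1,0,0,0,0,0)\ [1]$ 2. $(-2,0,-1,1,0,0,0,0);\ (1,0,1,0,0,0,0,0)\ [1]$ 3. $(-2,1,1,0,0,0,0,0);\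 (0,1,-1,0,0,0,0,0)\ [1]$ 4. $(-2,0,-1,1,0,0,0,0);\ (-2,-1,-1,1,1,0,0,0)\ [2]$ 5. $(-2,0,-1,1,0,0,0,0);\ (2,1,1,-1,1,0,0,0)\ [2]$ 6. $(-2,1,1,0,0,0,0,0);\ (0,0,0,2,1,1,1,-1)\ [2]$ 7. $(-2,1,1,0,0,0,0,0);\ (0,0,0,2,1,1,1,1)\ [2]$ 8. $(-1,0,0,1,1,1,1,-1);\ (-1,1,1,1,1,1,1,-1)\ [2]$ 9. $(-1,0,0,1,1,1,1,-1);\ (0,1,-1,0,0,0,0,0)\ [2]$ 10. $(-1,1,-1,1,1,1,0,0);\ (-1,-1,0,0,0,0,0,0)\ [2]$ 11. $(-1,1,-1,1,1,1,0,0);\ (0,0,0,0,0,0,1,1)\ [2]$ 12. $(-1,1,-1,1,1,1,0,0);\ (1,1,0,0,0,0,0,0)\ [2]$ 13. $(-2,0,-1,1,0,0,0,0);\ (-1,1,1,-1,1,1,1,1)\ [3]$ 14. $(-2,1,1,0,0,0,0,0);\ (0,0,0,1,1,0,0,0)\ [3]$ 15. $(-1,0,0,1,1,1,1,-1);\ (0,0,0,2,1,-1,-1,1)\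 [3]$ 16. $(-1,0,0,1,1,1,1,-1);\ (0,0,0,1,1,-1,-2,-1)\ [3]$ 17. $(-1,1,-1,1,1,1,0,0);\ (-2,-1,-1,0,-1,-1,0,0)\ [3]$ 18. $(-1,1,-1,1,1,1,0,0);\ (2,1,1,1,1,0,0,0)\ [3]$ 19. $(-2,0,-1,1,0,0,0,0);\ (-2,0,1,0,1,1,1,0)\ [4]$ 20. $(-2,0,-1,1,0,0,0,0);\ (-2,1,0,-1,1,1,0,0)\ [4]$ 21. $(-2,1,1,0,0,0,0,0);\ (0,-1,-2,1,1,1,0,0)\ [4]$ 22. $(-1,0,0,1,1,1,1,-1);\ (-2,-1,-1,0,0,-1,-1,0)\ [4]$ 23. $(-1,0,0,1,1,1,1,-1);\ (2,1,1,1,0,0,0,-1)\ [4]$ 24. $(-1,0,0,1,1,1,1,-1);\ (0,-1,-2,0,-1,-1,-1,0)\ [4]$ 25. $(-1,0,0,1,1,1,1,-1);\ (0,-1,-2,1,1,0,0,-1)\ [4]$ 26. $(-1,0,0,1,1,1,1,-1);\ (0,0,0,0,0,0,-1,-1)\ [4]$ 27. $(-1,1,-1,1,1,1,0,0);\ (-2,-1,-1,1,0,0,1,0)\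 [4]$ 28. $(-1,1,-1,1,1,1,0,0);\ (-2,0,1,0,0,-1,1,-1)\ [4]$ 29. $(-1,1,-1,1,1,1,0,0);\ (-2,0,1,1,-1,-1,0,0)\ [4]$ 30. $(-1,1,-1,1,1,1,0,0);\ (-2,1,0,-1,-1,-1,0,0)\ [4]$ 31. $(-1,1,-1,1,1,1,0,0);\ (-2,1,0,1,1,1,0,0)\ [4]$ 32. $(-1,1,-1,1,1,1,0,0);\ (2,1,1,0,0,-1,1,0)\ [4]$ 33. $(-1,1,-1,1,1,1,0,0);\ (-1,1,1,1,-1,-1,1,-1)\ [4]$ CMM 4, $3V_B=(2,1,1,0,0,0,0,0)$: 1. $(-2,1,-1,0,0,0,0,0);\ (-1,-1,0,0,0,0,0,0)\ [1]$ 2. $(-2,1,-1,0,0,0,0,0);\ (0,-1,1,0,0,0,0,0)\ [1]$ 3. $(2,-1,-1,0,0,0,0,0);\ (1,1,0,0,0,0,0,0)\ [1]$ 4. $(-2,0,0,1,1,0,0,0);\ (-2,-1,-1,1,-1,0,0,0)\ [2]$ 5. $(-2,0,0,1,1,0,0,0);\ (1,1,0,0,0,0,0,0)\ [2]$ 6.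 $(-2,1,-1,0,0,0,0,0);\ (1,-1,-1,1,1,1,1,-1)\ [2]$ 7. $(-2,1,-1,0,0,0,0,0);\ (1,-1,-1,1,1,1,1,1)\ [2]$ 8. $(-1,1,0,1,1,1,1,0);\ (-1,0,-1,0,0,0,0,0)\ [2]$ 9. $(-1,1,0,1,1,1,1,0);\ (-1,1,1,-1,-1,-1,-1,1)\ [2]$ 10. $(-1,1,0,1,1,1,1,0);\ (0,1,-1,0,0,0,0,0)\ [2]$ 11. $(2,-1,-1,0,0,0,0,0);\ (1,-1,-1,1,1,1,1,-1)\ [2]$ 12. $(2,-1,-1,0,0,0,0,0);\ (1,-1,-1,1,1,1,1,1)\ [2]$ 13. $(-2,0,0,1,1,0,0,0);\ (2,1,1,1,1,0,0,0)\ [3]$ 14. $(-2,0,0,1,1,0,0,0);\ (-1,1,1,1,1,1,1,-1)\ [3]$ 15. $(-2,1,-1,0,0,0,0,0);\ (-2,-1,-1,1,1,0,0,0)\ [3]$ 16. $(-1,1,0,1,1,1,1,0);\ (2,1,1,0,0,0,-1,-1)\ [3]$ 17. $(-1,1,0,1,1,1,1,0);\ (-1,1,1,-1,-1,-1,-1,-1)\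 [3]$ 18. $(2,-1,-1,0,0,0,0,0);\ (-2,-1,-1,1,1,0,0,0)\ [3]$ 19. $(-2,0,0,1,1,0,0,0);\ (-2,-1,-1,0,0,1,1,0)\ [4]$ 20. $(-2,0,0,1,1,0,0,0);\ (-2,1,0,0,0,1,1,-1)\ [4]$ 21. $(-2,0,0,1,1,0,0,0);\ (-2,1,0,0,0,1,1,1)\ [4]$ 22. $(-2,0,0,1,1,0,0,0);\ (2,1,1,0,-1,1,0,0)\ [4]$ 23. $(-2,0,0,1,1,0,0,0);\ (0,0,0,1,0,1,0,0)\ [4]$ 24. $(-2,1,-1,0,0,0,0,0);\ (2,-1,0,1,1,1,0,0)\ [4]$ 25. $(-2,1,-1,0,0,0,0,0);\ (0,-1,-2,1,1,1,0,0)\ [4]$ 26. $(-1,1,0,1,1,1,1,0);\ (-2,-1,-1,1,0,0,-1,0)\ [4]$ 27. $(-1,1,0,1,1,1,1,0);\ (-2,0,1,1,1,0,0,-1)\ [4]$ 28. $(-1,1,0,1,1,1,1,0);\ (-2,1,0,0,0,-1,-1,1)\ [4]$ 29. $(-1,1,0,1,1,1,1,0);\ (2,1,1,0,0,0,-1,1)\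 [4]$ 30. $(-1,1,0,1,1,1,1,0);\ (2,-1,0,0,0,-1,-1,1)\ [4]$ 31. $(-1,1,0,1,1,1,1,0);\ (2,0,-1,0,-1,-1,-1,0)\ [4]$ 32. $(-1,1,0,1,1,1,1,0);\ (-1,1,1,1,1,1,-1,1)\ [4]$ 33. $(2,-1,-1,0,0,0,0,0);\ (-2,1,0,1,1,1,0,0)\ [4]$ CMM 6, $3V_B=(2,1,1,0,0,0,0,0)$: 1. $(-1,0,0,1,0,0,0,0);\ (-2,0,-1,1,0,0,0,0)\ [1]$ 2. $(0,1,0,1,0,0,0,0);\ (-2,-1,0,1,0,0,0,0)\ [1]$ 3. $(0,1,0,1,0,0,0,0);\ (0,-1,2,1,0,0,0,0)\ [1]$ 4. $(-1,0,0,1,0,0,0,0);\ (-1,0,0,-1,1,1,1,-1)\ [2]$ 5. $(-1,0,0,1,0,0,0,0);\ (2,0,0,-1,1,0,0,0)\ [2]$ 6. $(0,1,0,1,0,0,0,0);\ (-2,0,-1,0,1,0,0,0)\ [2]$ 7. $(0,1,0,1,0,0,0,0);\ (0,-2,0,-1,1,0,0,0)\ [2]$ 8. $(-2,0,-1,1,1,1,0,0);\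 (-1,1,-1,1,1,1,0,0)\ [2]$ 9. $(-2,0,-1,1,1,1,0,0);\ (0,1,0,1,1,1,1,1)\ [2]$ 10. $(-2,0,-1,1,1,1,0,0);\ (1,1,1,1,1,1,0,0)\ [2]$ 11. $(-2,1,1,1,1,0,0,0);\ (0,2,-1,0,-1,0,0,0)\ [2]$ 12. $(-2,1,1,1,1,0,0,0);\ (0,0,-2,1,1,0,0,0)\ [2]$ 13. $(-1,0,0,1,0,0,0,0);\ (-1,0,0,-1,1,1,1,1)\ [3]$ 14. $(0,1,0,1,0,0,0,0);\ (-1,-1,1,1,1,1,0,0)\ [3]$ 15. $(-2,0,-1,1,1,1,0,0);\ (-2,0,-1,1,0,0,0,0)\ [3]$ 16. $(-2,0,-1,1,1,1,0,0);\ (-1,-1,1,1,-1,-1,0,0)\ [3]$ 17. $(-2,1,1,1,1,0,0,0);\ (-2,1,1,0,0,0,0,0)\ [3]$ 18. $(-2,1,1,1,1,0,0,0);\ (2,0,0,-1,-1,0,0,0)\ [3]$ 19. $(-1,0,0,1,0,0,0,0);\ (-1,1,-1,-1,1,1,0,0)\ [4]$ 20. $(0,1,0,1,0,0,0,0);\ (2,0,0,0,1,1,0,0)\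 [4]$ 21. $(0,1,0,1,0,0,0,0);\ (-1,1,-1,-1,1,1,0,0)\ [4]$ 22. $(-2,0,-1,1,1,1,0,0);\ (-2,-1,0,0,0,-1,0,0)\ [4]$ 23. $(-2,0,-1,1,1,1,0,0);\ (-2,1,1,0,0,0,0,0)\ [4]$ 24. $(-2,0,-1,1,1,1,0,0);\ (-1,-1,1,0,0,-1,1,-1)\ [4]$ 25. $(-2,0,-1,1,1,1,0,0);\ (-1,-1,1,0,0,-1,1,1)\ [4]$ 26. $(-2,0,-1,1,1,1,0,0);\ (-1,-1,1,1,1,0,1,0)\ [4]$ 27. $(-2,0,-1,1,1,1,0,0);\ (2,0,0,0,-1,-1,0,0)\ [4]$ 28. $(-2,0,-1,1,1,1,0,0);\ (-1,1,-1,-1,-1,-1,0,0)\ [4]$ 29. $(-2,1,1,1,1,0,0,0);\ (-2,0,-1,0,0,1,0,0)\ [4]$ 30. $(-2,1,1,1,1,0,0,0);\ (-1,0,0,-1,-1,1,1,-1)\ [4]$ 31. $(-2,1,1,1,1,0,0,0);\ (2,0,0,1,0,1,0,0)\ [4]$ 32. $(-2,1,1,1,1,0,0,0);\ (-1,1,-1,-1,-1,1,0,0)\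 [4]$ 33. $(-2,1,1,1,1,0,0,0);\ (0,-1,-1,0,-1,1,1,1)\ [4]$ CMM 8, $3V_B=(1,1,0,0,0,0,0,0)$: 1. $(0,0,1,1,1,1,0,0);\ (0,0,-1,-1,-1,-1,1,1)\ [1]$ 2. $(0,0,1,1,1,1,0,0);\ (-1,-2,0,0,0,-1,0,0)\ [2]$ 3. $(0,0,1,1,1,1,0,0);\ (0,0,2,0,0,0,1,-1)\ [2]$ 4. $(0,0,1,1,1,1,0,0);\ (0,0,-1,-1,-1,-1,1,-1)\ [3]$ 5. $(0,0,1,1,1,1,0,0);\ (0,0,2,0,0,0,1,1)\ [4]$ CMM 8, $3V_B=(2,1,1,1,1,0,0,0)$: 1. $(-1,0,0,0,-1,1,1,0);\ (-1,-1,-1,-1,-1,0,0,-1)\ [2]$ 2. $(-1,0,0,0,-1,1,1,0);\ (-1,1,1,1,-1,0,0,1)\ [2]$ 3. $(0,1,1,1,0,1,0,0);\ (1,-1,-1,-1,1,-1,0,0)\ [2]$ 4. $(-1,0,0,0,-1,1,1,0);\ (-1,1,1,0,0,-1,-1,1)\ [3]$ 5. $(-1,0,0,0,-1,1,1,0);\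 (0,0,-1,-1,-1,-1,-1,-1)\ [3]$ 6. $(-1,1,1,0,0,1,0,0);\ (-2,0,0,-1,-1,0,0,0)\ [3]$ 7. $(-1,1,1,0,0,1,0,0);\ (1,1,1,1,1,1,0,0)\ [3]$ 8. $(-1,0,0,0,-1,1,1,0);\ (-2,0,-1,-1,0,0,0,0)\ [4]$ 9. $(-1,0,0,0,-1,1,1,0);\ (-2,0,0,0,1,1,0,0)\ [4]$ 10. $(-1,0,0,0,-1,1,1,0);\ (-2,1,0,0,0,0,0,1)\ [4]$ 11. $(-1,0,0,0,-1,1,1,0);\ (-1,0,-1,-1,1,0,-1,1)\ [4]$ 12. $(-1,0,0,0,-1,1,1,0);\ (-1,1,1,-1,1,0,-1,0)\ [4]$ 13. $(-1,1,1,0,0,1,0,0);\ (-2,1,0,0,0,-1,0,0)\ [4]$ 14. $(-1,1,1,0,0,1,0,0);\ (-1,-1,-1,-1,-1,0,1,0)\ [4]$ 15. $(-1,1,1,0,0,1,0,0);\ (-1,-1,-1,1,0,0,1,-1)\ [4]$ 16. $(0,1,1,1,0,1,0,0);\ (-2,0,0,0,1,-1,0,0)\ [4]$ 17. $(0,1,1,1,0,1,0,0);\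 (0,1,0,-2,1,0,0,0)\ [4]$ CMM 9, $3V_B=(1,1,0,0,0,0,0,0)$: 1. $(1,0,1,0,0,0,0,0);\ (-1,1,-1,1,1,1,1,1)\ [1]$ 2. $(1,0,1,0,0,0,0,0);\ (1,2,0,1,1,1,0,0)\ [2]$ 3. $(-1,-1,1,1,1,1,1,-1);\ (0,0,2,0,-1,-1,-1,1)\ [2]$ 4. $(-1,-1,1,1,1,1,1,-1);\ (0,0,0,0,0,-1,-1,0)\ [3]$ 5. $(-1,-1,1,1,1,1,1,-1);\ (-1,-2,1,0,0,0,-1,-1)\ [4]$ CMM 9, $3V_B=(2,1,1,1,1,0,0,0)$: 1. $(-1,0,0,0,0,1,0,0);\ (-1,0,0,0,-1,0,0,0)\ [2]$ 2. $(0,1,0,0,0,1,0,0);\ (-1,-1,-1,-1,-1,-1,1,1)\ [2]$ 3. $(-2,0,0,0,-1,1,1,1);\ (-1,-1,-1,-1,-1,1,1,-1)\ [2]$ 4. $(-1,0,0,0,0,1,0,0);\ (-2,1,0,0,0,-1,1,-1)\ [3]$ 5. $(-2,0,0,0,-1,1,1,1);\ (-2,0,0,-1,-1,1,1,0)\ [3]$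 6. $(-1,0,0,0,0,1,0,0);\ (-2,0,0,-1,-1,-1,1,0)\ [4]$ 7. $(0,1,0,0,0,1,0,0);\ (-2,-1,0,0,-1,-1,1,0)\ [4]$ 8. $(-2,0,0,0,-1,1,1,-1);\ (-2,0,0,-1,-1,1,0,-1)\ [4]$ 9. $(-2,0,0,0,-1,1,1,-1);\ (-2,1,0,0,0,-1,-1,1)\ [4]$ 10. $(-2,0,0,0,-1,1,1,-1);\ (-2,1,0,0,0,1,1,-1)\ [4]$ 11. $(-2,0,0,0,-1,1,1,-1);\ (-1,-1,-1,-1,-1,1,-1,-1)\ [4]$ 12. $(-2,0,0,0,-1,1,1,-1);\ (-1,1,1,-1,1,-1,-1,1)\ [4]$ 13. $(-2,0,0,0,-1,1,1,-1);\ (-1,1,1,1,-1,1,-1,-1)\ [4]$ 14. $(-2,0,0,0,-1,1,1,-1);\ (1,-1,-1,-1,1,1,-1,-1)\ [4]$ 15. $(-2,0,0,0,-1,1,1,-1);\ (1,1,1,1,1,1,-1,-1)\ [4]$ 16. $(-2,0,0,0,-1,1,1,1);\ (-2,0,-1,-1,0,1,0,-1)\ [4]$ -/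

import Mathlib

open scoped Matrix

namespace HiddenSector

/-- The root lattice of `E8` in its standard coordinates: all entries are integers, or all entries
are integers plus one half, and the underlying integers have even sum. -/
def e8Lattice : Set (Fin 8 → ℝ) :=
  {x | ∃ n : Fin 8 → ℤ, Even (∑ i, n i) ∧
    ((∀ i, x i = (n i : ℝ)) ∨ (∀ i, x i = (n i : ℝ) + 1 / 2))}

/-- The 240 nonzero roots of `E8`: the lattice vectors of squared length two. -/
def e8Roots : Set (Fin 8 → ℝ) :=
  {e | e ∈ e8Lattice ∧ e ⬝ᵥ e = 2}

/-- The Weyl reflection `P ↦ P - (P · e) e` in a root `e`. -/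
def weylReflection (e P : Fin 8 → ℝ) : Fin 8 → ℝ :=
  P - (P ⬝ᵥ e) • e

/-- The `E8 × E8` root lattice; a sixteen-dimensional vector is indexed by `Fin 8 ⊕ Fin 8`. -/
def e8e8Lattice : Set (Fin 8 ⊕ Fin 8 → ℝ) :=
  {x | (fun i => x (Sum.inl i)) ∈ e8Lattice ∧ (fun i => x (Sum.inr i)) ∈ e8Lattice}

/-- An embedding is a triple of vectors `![V, a₁, a₃]`: the twist embedding `V` (index `0`) and the
two Wilson lines `a₁` (index `1`) and `a₃` (index `2`).  With `ι = Fin 8` it embeds one `E8` factor,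
with `ι = Fin 8 ⊕ Fin 8` it is a full embedding. -/
abbrev Embedding (ι : Type) : Type := Fin 3 → ι → ℝ

/-- The direct sum of an observable sector embedding and a hidden sector embedding:
`V = (V_A; V_B)` and `a_i = (a_iA; a_iB)`. -/
def Embedding.join (A B : Embedding (Fin 8)) : Embedding (Fin 8 ⊕ Fin 8) :=
  fun p => Sum.elim (A p) (B p)

/-- The modular invariance conditions on a full embedding: `3V` and `3a_i` lie in the `E8 × E8`
root lattice, and `3 V·V`, `3 a_i·a_j`, `3 V·a_i` are integers. -/
def IsConsistent (E : Embedding (Fin 8 ⊕ Fin 8)) : Prop :=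
  (∀ p, (3 : ℝ) • E p ∈ e8e8Lattice) ∧ ∀ p q, ∃ k : ℤ, 3 * (E p ⬝ᵥ E q) = (k : ℝ)

/-- One elementary operation on a hidden sector embedding. -/
inductive Operation : Embedding (Fin 8) → Embedding (Fin 8) → Prop
  /-- Translate one of the three vectors by a lattice vector. -/
  | translate (E : Embedding (Fin 8)) (p : Fin 3) (l : Fin 8 → ℝ) (hl : l ∈ e8Lattice) :
      Operation E (Function.update E p (E p + l))
  /-- Reflect all three vectors simultaneously in the same root. -/
  | reflect (E : Embedding (Fin 8)) (e : Fin 8 → ℝ) (he : e ∈ e8Roots) :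
      Operation E (fun p => weylReflection e (E p))

/-- Two hidden sector embeddings are equivalent if a finite sequence of elementary operations takes
the first to the second.  (Each operation is inverted by an operation.) -/
def Equivalent (E F : Embedding (Fin 8)) : Prop :=
  Relation.ReflTransGen Operation E F

/-- The roots of `E8` whose gauge bosons survive: those with integral products with `V`, `a₁`
and `a₃`. -/
def unbrokenRoots (E : Embedding (Fin 8)) : Set (Fin 8 → ℝ) :=
  {e | e ∈ e8Roots ∧ ∀ p, ∃ k : ℤ, E p ⬝ᵥ e = (k : ℝ)}

/-- `α` is a system of simple roots of the set of roots `Φ`. -/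
def IsSimpleSystem {ι : Type} [Fintype ι] (Φ : Set (Fin 8 → ℝ)) (α : ι → Fin 8 → ℝ) : Prop :=
  LinearIndependent ℝ α ∧ (∀ i, α i ∈ Φ) ∧
    ∀ e ∈ Φ, ∃ c : ι → ℕ, e = ∑ i, c i • α i ∨ e = -∑ i, c i • α i

/-- The unbroken gauge group has (locally) the form `K × U(1)^u`, where `K` is semisimple with
Cartan matrix `C`, and the total rank is eight.  All roots have squared length two, so the Cartan
integers are just the scalar products of the simple roots. -/
def HasGaugeGroup {ι : Type} [Fintype ι] (E : Embedding (Fin 8)) (C : Matrix ι ι ℤ) (u : ℕ) : Prop :=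
  Fintype.card ι + u = 8 ∧
    ∃ α : ι → Fin 8 → ℝ, IsSimpleSystem (unbrokenRoots E) α ∧ ∀ i j, α i ⬝ᵥ α j = (C i j : ℝ)

/-- The Cartan matrix of a product of two semisimple groups. -/
def cartanProd {ι κ : Type} (C : Matrix ι ι ℤ) (D : Matrix κ κ ℤ) : Matrix (ι ⊕ κ) (ι ⊕ κ) ℤ :=
  Matrix.fromBlocks C 0 0 D

/-- Labels of the five hidden sector gauge groups. -/
inductive GaugeCase
  | case1 | case2 | case3 | case4 | case5

/-- The hidden sector gauge group of `E` is the one with the given label. -/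
def HasCase (E : Embedding (Fin 8)) : GaugeCase → Prop
  /- SO(10) × U(1)^3 -/
  | .case1 => HasGaugeGroup E (CartanMatrix.D 5) 3
  /- SU(5) × SU(2) × U(1)^3 -/
  | .case2 => HasGaugeGroup E (cartanProd (CartanMatrix.A 4) (CartanMatrix.A 1)) 3
  /- SU(4) × SU(2)^2 × U(1)^3 -/
  | .case3 => HasGaugeGroup E
      (cartanProd (CartanMatrix.A 3) (cartanProd (CartanMatrix.A 1) (CartanMatrix.A 1))) 3
  /- SU(3) × SU(2)^2 × U(1)^4 -/
  | .case4 => HasGaugeGroup E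
      (cartanProd (CartanMatrix.A 2) (cartanProd (CartanMatrix.A 1) (CartanMatrix.A 1))) 4
  /- SU(2)^2 × U(1)^6 -/
  | .case5 => HasGaugeGroup E (cartanProd (CartanMatrix.A 1) (CartanMatrix.A 1)) 6

/-- The six representative CMM observable sector embeddings. -/
inductive CMM
  | cmm1 | cmm2 | cmm4 | cmm6 | cmm8 | cmm9

/-- The vectors `![3V_A, 3a_1A, 3a_3A]`. -/
def CMM.triple : CMM → Fin 3 → Fin 8 → ℤ
  | .cmm1 => ![![-1, -1, 0, 0, 0, 2, 0, 0],
      ![1, 1, -1, -1, 2, 0, 0, 0],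
      ![0, 0, 0, 0, 0, 0, 2, 0]]
  | .cmm2 => ![![-1, -1, 0, 0, 0, 2, 0, 0],
      ![1, 1, -1, -1, -1, -1, 0, 0],
      ![0, 0, 0, 0, 0, 0, 2, 0]]
  | .cmm4 => ![![-1, -1, 0, 0, 0, 2, 0, 0],
      ![1, 1, -1, -1, -1, 0, 1, 0],
      ![0, 0, 0, 0, 0, 0, 2, 0]]
  | .cmm6 => ![![-1, -1, 0, 0, 0, 2, 0, 0],
      ![1, 1, -1, -1, -1, 2, 1, 0],
      ![0, 0, 0, 0, 0, 1, 1, 2]]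
  | .cmm8 => ![![-1, -1, 0, 0, 0, 1, 1, 0],
      ![1, 1, -1, -1, -1, 1, 1, 1],
      ![0, 0, 0, 0, 0, 1, 2, 1]]
  | .cmm9 => ![![-1, -1, 0, 0, 0, 1, 1, 0],
      ![1, 1, -1, -1, -1, -2, 0, 1],
      ![0, 0, 0, 0, 0, 0, 0, 2]]

/-- The observable sector embedding `![V_A, a_1A, a_3A]`. -/
noncomputable def CMM.observable (m : CMM) : Embedding (Fin 8) :=
  fun p i => (m.triple p i : ℝ) / 3

/-- The hidden sector embedding `B` completes the observable sector embedding `m` to a consistent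
embedding. -/
def CMM.IsCompletedBy (m : CMM) (B : Embedding (Fin 8)) : Prop :=
  IsConsistent (m.observable.join B)

/-- The eight tables of hidden sector embeddings: one for each of CMM 1, 2, 4, 6 and two, with
different `V_B`, for each of CMM 8, 9. -/
inductive Table
  | t1 | t2 | t4 | t6 | t8a | t8b | t9a | t9b
  deriving DecidableEq

instance : Fintype Table where
  elems := {.t1, .t2, .t4, .t6, .t8a, .t8b, .t9a, .t9b}
  complete t := by cases t <;> simp

/-- The observable sector embedding to which a table belongs. -/
def Table.cmm : Table → CMM
  | .t1 => .cmm1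
  | .t2 => .cmm2
  | .t4 => .cmm4
  | .t6 => .cmm6
  | .t8a => .cmm8
  | .t8b => .cmm8
  | .t9a => .cmm9
  | .t9b => .cmm9

/-- The common vector `3V_B` of the entries of a table. -/
def Table.twist : Table → Fin 8 → ℤ
  | .t1 => ![2, 1, 1, 0, 0, 0, 0, 0]
  | .t2 => ![2, 1, 1, 0, 0, 0, 0, 0]
  | .t4 => ![2, 1, 1, 0, 0, 0, 0, 0]
  | .t6 => ![2, 1, 1, 0, 0, 0, 0, 0]
  | .t8a => ![1, 1, 0, 0, 0, 0, 0, 0]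
  | .t8b => ![2, 1, 1, 1, 1, 0, 0, 0]
  | .t9a => ![1, 1, 0, 0, 0, 0, 0, 0]
  | .t9b => ![2, 1, 1, 1, 1, 0, 0, 0]

/-- An entry of a table: the vectors `3a_1B`, `3a_3B` and the hidden sector gauge group. -/
structure Entry where
  a1 : Fin 8 → ℤ
  a3 : Fin 8 → ℤ
  group : GaugeCase

/-- The hidden sector embedding `![V_B, a_1B, a_3B]` given by an entry of the table `t`. -/
noncomputable def Table.hidden (t : Table) (r : Entry) : Embedding (Fin 8) :=
  fun p i => ((![t.twist, r.a1, r.a3] p i : ℤ) : ℝ) / 3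

/-- The displayed entries of the tables, in their order. -/
def Table.entries : Table → List Entry
  | .t1 => [
      ⟨![-2, 0, 0, 0, 0, 0, 0, 0], ![0, 1, -1, 0, 0, 0, 0, 0], .case1⟩,
      ⟨![0, 2, 0, 0, 0, 0, 0, 0], ![-1, 0, -1, 0, 0, 0, 0, 0], .case1⟩,
      ⟨![0, 2, 0, 0, 0, 0, 0, 0], ![1, 0, 1, 0, 0, 0, 0, 0], .case1⟩,
      ⟨![-2, 0, 0, 0, 0, 0, 0, 0], ![0, 0, 0, 2, 1, 1, 1, -1], .case2⟩,
      ⟨![-2, 0, 0, 0, 0, 0, 0, 0], ![0, 0, 0, 2, 1, 1, 1, 1], .case2⟩,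
      ⟨![-1, 1, 0, 1, 1, 0, 0, 0], ![-1, -1, 0, 0, 0, 0, 0, 0], .case2⟩,
      ⟨![-1, 1, 0, 1, 1, 0, 0, 0], ![0, 0, 0, 1, -1, 0, 0, 0], .case2⟩,
      ⟨![-1, 1, 0, 1, 1, 0, 0, 0], ![1, 1, 0, 0, 0, 0, 0, 0], .case2⟩,
      ⟨![0, 1, 1, 1, 1, 0, 0, 0], ![0, 0, 0, 1, -1, 0, 0, 0], .case2⟩,
      ⟨![0, 1, 1, 1, 1, 0, 0, 0], ![0, 1, -1, 0, 0, 0, 0, 0], .case2⟩,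
      ⟨![0, 2, 0, 0, 0, 0, 0, 0], ![0, 0, 0, 2, 1, 1, 1, -1], .case2⟩,
      ⟨![0, 2, 0, 0, 0, 0, 0, 0], ![0, 0, 0, 2, 1, 1, 1, 1], .case2⟩,
      ⟨![-2, 0, 0, 0, 0, 0, 0, 0], ![0, 0, 0, 1, 1, 0, 0, 0], .case3⟩,
      ⟨![-1, 1, 0, 1, 1, 0, 0, 0], ![-2, -1, -1, 1, 1, 0, 0, 0], .case3⟩,
      ⟨![-1, 1, 0, 1, 1, 0, 0, 0], ![2, 1, 1, -1, -1, 0, 0, 0], .case3⟩,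
      ⟨![0, 1, 1, 1, 1, 0, 0, 0], ![-2, -1, -1, 1, 1, 0, 0, 0], .case3⟩,
      ⟨![0, 1, 1, 1, 1, 0, 0, 0], ![2, 1, 1, -1, -1, 0, 0, 0], .case3⟩,
      ⟨![0, 2, 0, 0, 0, 0, 0, 0], ![0, 0, 0, 1, 1, 0, 0, 0], .case3⟩,
      ⟨![-2, 0, 0, 0, 0, 0, 0, 0], ![0, -1, -2, 1, 1, 1, 0, 0], .case4⟩,
      ⟨![-1, 1, 0, 1, 1, 0, 0, 0], ![-2, -1, -1, 0, -1, 1, 0, 0], .case4⟩,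
      ⟨![-1, 1, 0, 1, 1, 0, 0, 0], ![-2, 0, 1, -1, -1, 1, 0, 0], .case4⟩,
      ⟨![-1, 1, 0, 1, 1, 0, 0, 0], ![-2, 1, 0, 0, 0, 1, 1, -1], .case4⟩,
      ⟨![-1, 1, 0, 1, 1, 0, 0, 0], ![-2, 1, 0, 0, 0, 1, 1, 1], .case4⟩,
      ⟨![-1, 1, 0, 1, 1, 0, 0, 0], ![2, 1, 1, 1, 0, 1, 0, 0], .case4⟩,
      ⟨![-1, 1, 0, 1, 1, 0, 0, 0], ![2, -1, 0, 0, 0, 1, 1, 1], .case4⟩,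
      ⟨![-1, 1, 0, 1, 1, 0, 0, 0], ![-1, 1, 1, -1, -1, 1, 1, -1], .case4⟩,
      ⟨![0, 1, 1, 1, 1, 0, 0, 0], ![-2, -1, -1, 0, -1, 1, 0, 0], .case4⟩,
      ⟨![0, 1, 1, 1, 1, 0, 0, 0], ![-2, 1, 0, 1, 1, 1, 0, 0], .case4⟩,
      ⟨![0, 1, 1, 1, 1, 0, 0, 0], ![2, 0, -1, -1, -1, 1, 0, 0], .case4⟩,
      ⟨![0, 1, 1, 1, 1, 0, 0, 0], ![2, 1, 1, 1, 0, 1, 0, 0], .case4⟩,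
      ⟨![0, 1, 1, 1, 1, 0, 0, 0], ![-1, 1, 1, -1, -1, 1, 1, -1], .case4⟩,
      ⟨![0, 2, 0, 0, 0, 0, 0, 0], ![-2, 0, 1, 1, 1, 1, 0, 0], .case4⟩,
      ⟨![0, 2, 0, 0, 0, 0, 0, 0], ![2, 0, -1, 1, 1, 1, 0, 0], .case4⟩]
  | .t2 => [
      ⟨![-2, 0, -1, 1, 0, 0, 0, 0], ![-1, 0, -1, 0, 0, 0, 0, 0], .case1⟩,
      ⟨![-2, 0, -1, 1, 0, 0, 0, 0], ![1, 0, 1, 0, 0, 0, 0, 0], .case1⟩,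
      ⟨![-2, 1, 1, 0, 0, 0, 0, 0], ![0, 1, -1, 0, 0, 0, 0, 0], .case1⟩,
      ⟨![-2, 0, -1, 1, 0, 0, 0, 0], ![-2, -1, -1, 1, 1, 0, 0, 0], .case2⟩,
      ⟨![-2, 0, -1, 1, 0, 0, 0, 0], ![2, 1, 1, -1, 1, 0, 0, 0], .case2⟩,
      ⟨![-2, 1, 1, 0, 0, 0, 0, 0], ![0, 0, 0, 2, 1, 1, 1, -1], .case2⟩,
      ⟨![-2, 1, 1, 0, 0, 0, 0, 0], ![0, 0, 0, 2, 1, 1, 1, 1], .case2⟩,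
      ⟨![-1, 0, 0, 1, 1, 1, 1, -1], ![-1, 1, 1, 1, 1, 1, 1, -1], .case2⟩,
      ⟨![-1, 0, 0, 1, 1, 1, 1, -1], ![0, 1, -1, 0, 0, 0, 0, 0], .case2⟩,
      ⟨![-1, 1, -1, 1, 1, 1, 0, 0], ![-1, -1, 0, 0, 0, 0, 0, 0], .case2⟩,
      ⟨![-1, 1, -1, 1, 1, 1, 0, 0], ![0, 0, 0, 0, 0, 0, 1, 1], .case2⟩,
      ⟨![-1, 1, -1, 1, 1, 1, 0, 0], ![1, 1, 0, 0, 0, 0, 0, 0], .case2⟩,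
      ⟨![-2, 0, -1, 1, 0, 0, 0, 0], ![-1, 1, 1, -1, 1, 1, 1, 1], .case3⟩,
      ⟨![-2, 1, 1, 0, 0, 0, 0, 0], ![0, 0, 0, 1, 1, 0, 0, 0], .case3⟩,
      ⟨![-1, 0, 0, 1, 1, 1, 1, -1], ![0, 0, 0, 2, 1, -1, -1, 1], .case3⟩,
      ⟨![-1, 0, 0, 1, 1, 1, 1, -1], ![0, 0, 0, 1, 1, -1, -2, -1], .case3⟩,
      ⟨![-1, 1, -1, 1, 1, 1, 0, 0], ![-2, -1, -1, 0, -1, -1, 0, 0], .case3⟩,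
      ⟨![-1, 1, -1, 1, 1, 1, 0, 0], ![2, 1, 1, 1, 1, 0, 0, 0], .case3⟩,
      ⟨![-2, 0, -1, 1, 0, 0, 0, 0], ![-2, 0, 1, 0, 1, 1, 1, 0], .case4⟩,
      ⟨![-2, 0, -1, 1, 0, 0, 0, 0], ![-2, 1, 0, -1, 1, 1, 0, 0], .case4⟩,
      ⟨![-2, 1, 1, 0, 0, 0, 0, 0], ![0, -1, -2, 1, 1, 1, 0, 0], .case4⟩,
      ⟨![-1, 0, 0, 1, 1, 1, 1, -1], ![-2, -1, -1, 0, 0, -1, -1, 0], .case4⟩,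
      ⟨![-1, 0, 0, 1, 1, 1, 1, -1], ![2, 1, 1, 1, 0, 0, 0, -1], .case4⟩,
      ⟨![-1, 0, 0, 1, 1, 1, 1, -1], ![0, -1, -2, 0, -1, -1, -1, 0], .case4⟩,
      ⟨![-1, 0, 0, 1, 1, 1, 1, -1], ![0, -1, -2, 1, 1, 0, 0, -1], .case4⟩,
      ⟨![-1, 0, 0, 1, 1, 1, 1, -1], ![0, 0, 0, 0, 0, 0, -1, -1], .case4⟩,
      ⟨![-1, 1, -1, 1, 1, 1, 0, 0], ![-2, -1, -1, 1, 0, 0, 1, 0], .case4⟩,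
      ⟨![-1, 1, -1, 1, 1, 1, 0, 0], ![-2, 0, 1, 0, 0, -1, 1, -1], .case4⟩,
      ⟨![-1, 1, -1, 1, 1, 1, 0, 0], ![-2, 0, 1, 1, -1, -1, 0, 0], .case4⟩,
      ⟨![-1, 1, -1, 1, 1, 1, 0, 0], ![-2, 1, 0, -1, -1, -1, 0, 0], .case4⟩,
      ⟨![-1, 1, -1, 1, 1, 1, 0, 0], ![-2, 1, 0, 1, 1, 1, 0, 0], .case4⟩,
      ⟨![-1, 1, -1, 1, 1, 1, 0, 0], ![2, 1, 1, 0, 0, -1, 1, 0], .case4⟩,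
      ⟨![-1, 1, -1, 1, 1, 1, 0, 0], ![-1, 1, 1, 1, -1, -1, 1, -1], .case4⟩]
  | .t4 => [
      ⟨![-2, 1, -1, 0, 0, 0, 0, 0], ![-1, -1, 0, 0, 0, 0, 0, 0], .case1⟩,
      ⟨![-2, 1, -1, 0, 0, 0, 0, 0], ![0, -1, 1, 0, 0, 0, 0, 0], .case1⟩,
      ⟨![2, -1, -1, 0, 0, 0, 0, 0], ![1, 1, 0, 0, 0, 0, 0, 0], .case1⟩,
      ⟨![-2, 0, 0, 1, 1, 0, 0, 0], ![-2, -1, -1, 1, -1, 0, 0, 0], .case2⟩,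
      ⟨![-2, 0, 0, 1, 1, 0, 0, 0], ![1, 1, 0, 0, 0, 0, 0, 0], .case2⟩,
      ⟨![-2, 1, -1, 0, 0, 0, 0, 0], ![1, -1, -1, 1, 1, 1, 1, -1], .case2⟩,
      ⟨![-2, 1, -1, 0, 0, 0, 0, 0], ![1, -1, -1, 1, 1, 1, 1, 1], .case2⟩,
      ⟨![-1, 1, 0, 1, 1, 1, 1, 0], ![-1, 0, -1, 0, 0, 0, 0, 0], .case2⟩,
      ⟨![-1, 1, 0, 1, 1, 1, 1, 0], ![-1, 1, 1, -1, -1, -1, -1, 1], .case2⟩,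
      ⟨![-1, 1, 0, 1, 1, 1, 1, 0], ![0, 1, -1, 0, 0, 0, 0, 0], .case2⟩,
      ⟨![2, -1, -1, 0, 0, 0, 0, 0], ![1, -1, -1, 1, 1, 1, 1, -1], .case2⟩,
      ⟨![2, -1, -1, 0, 0, 0, 0, 0], ![1, -1, -1, 1, 1, 1, 1, 1], .case2⟩,
      ⟨![-2, 0, 0, 1, 1, 0, 0, 0], ![2, 1, 1, 1, 1, 0, 0, 0], .case3⟩,
      ⟨![-2, 0, 0, 1, 1, 0, 0, 0], ![-1, 1, 1, 1, 1, 1, 1, -1], .case3⟩,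
      ⟨![-2, 1, -1, 0, 0, 0, 0, 0], ![-2, -1, -1, 1, 1, 0, 0, 0], .case3⟩,
      ⟨![-1, 1, 0, 1, 1, 1, 1, 0], ![2, 1, 1, 0, 0, 0, -1, -1], .case3⟩,
      ⟨![-1, 1, 0, 1, 1, 1, 1, 0], ![-1, 1, 1, -1, -1, -1, -1, -1], .case3⟩,
      ⟨![2, -1, -1, 0, 0, 0, 0, 0], ![-2, -1, -1, 1, 1, 0, 0, 0], .case3⟩,
      ⟨![-2, 0, 0, 1, 1, 0, 0, 0], ![-2, -1, -1, 0, 0, 1, 1, 0], .case4⟩,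
      ⟨![-2, 0, 0, 1, 1, 0, 0, 0], ![-2, 1, 0, 0, 0, 1, 1, -1], .case4⟩,
      ⟨![-2, 0, 0, 1, 1, 0, 0, 0], ![-2, 1, 0, 0, 0, 1, 1, 1], .case4⟩,
      ⟨![-2, 0, 0, 1, 1, 0, 0, 0], ![2, 1, 1, 0, -1, 1, 0, 0], .case4⟩,
      ⟨![-2, 0, 0, 1, 1, 0, 0, 0], ![0, 0, 0, 1, 0, 1, 0, 0], .case4⟩,
      ⟨![-2, 1, -1, 0, 0, 0, 0, 0], ![2, -1, 0, 1, 1, 1, 0, 0], .case4⟩,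
      ⟨![-2, 1, -1, 0, 0, 0, 0, 0], ![0, -1, -2, 1, 1, 1, 0, 0], .case4⟩,
      ⟨![-1, 1, 0, 1, 1, 1, 1, 0], ![-2, -1, -1, 1, 0, 0, -1, 0], .case4⟩,
      ⟨![-1, 1, 0, 1, 1, 1, 1, 0], ![-2, 0, 1, 1, 1, 0, 0, -1], .case4⟩,
      ⟨![-1, 1, 0, 1, 1, 1, 1, 0], ![-2, 1, 0, 0, 0, -1, -1, 1], .case4⟩,
      ⟨![-1, 1, 0, 1, 1, 1, 1, 0], ![2, 1, 1, 0, 0, 0, -1, 1], .case4⟩,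
      ⟨![-1, 1, 0, 1, 1, 1, 1, 0], ![2, -1, 0, 0, 0, -1, -1, 1], .case4⟩,
      ⟨![-1, 1, 0, 1, 1, 1, 1, 0], ![2, 0, -1, 0, -1, -1, -1, 0], .case4⟩,
      ⟨![-1, 1, 0, 1, 1, 1, 1, 0], ![-1, 1, 1, 1, 1, 1, -1, 1], .case4⟩,
      ⟨![2, -1, -1, 0, 0, 0, 0, 0], ![-2, 1, 0, 1, 1, 1, 0, 0], .case4⟩]
  | .t6 => [
      ⟨![-1, 0, 0, 1, 0, 0, 0, 0], ![-2, 0, -1, 1, 0, 0, 0, 0], .case1⟩,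
      ⟨![0, 1, 0, 1, 0, 0, 0, 0], ![-2, -1, 0, 1, 0, 0, 0, 0], .case1⟩,
      ⟨![0, 1, 0, 1, 0, 0, 0, 0], ![0, -1, 2, 1, 0, 0, 0, 0], .case1⟩,
      ⟨![-1, 0, 0, 1, 0, 0, 0, 0], ![-1, 0, 0, -1, 1, 1, 1, -1], .case2⟩,
      ⟨![-1, 0, 0, 1, 0, 0, 0, 0], ![2, 0, 0, -1, 1, 0, 0, 0], .case2⟩,
      ⟨![0, 1, 0, 1, 0, 0, 0, 0], ![-2, 0, -1, 0, 1, 0, 0, 0], .case2⟩,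
      ⟨![0, 1, 0, 1, 0, 0, 0, 0], ![0, -2, 0, -1, 1, 0, 0, 0], .case2⟩,
      ⟨![-2, 0, -1, 1, 1, 1, 0, 0], ![-1, 1, -1, 1, 1, 1, 0, 0], .case2⟩,
      ⟨![-2, 0, -1, 1, 1, 1, 0, 0], ![0, 1, 0, 1, 1, 1, 1, 1], .case2⟩,
      ⟨![-2, 0, -1, 1, 1, 1, 0, 0], ![1, 1, 1, 1, 1, 1, 0, 0], .case2⟩,
      ⟨![-2, 1, 1, 1, 1, 0, 0, 0], ![0, 2, -1, 0, -1, 0, 0, 0], .case2⟩,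
      ⟨![-2, 1, 1, 1, 1, 0, 0, 0], ![0, 0, -2, 1, 1, 0, 0, 0], .case2⟩,
      ⟨![-1, 0, 0, 1, 0, 0, 0, 0], ![-1, 0, 0, -1, 1, 1, 1, 1], .case3⟩,
      ⟨![0, 1, 0, 1, 0, 0, 0, 0], ![-1, -1, 1, 1, 1, 1, 0, 0], .case3⟩,
      ⟨![-2, 0, -1, 1, 1, 1, 0, 0], ![-2, 0, -1, 1, 0, 0, 0, 0], .case3⟩,
      ⟨![-2, 0, -1, 1, 1, 1, 0, 0], ![-1, -1, 1, 1, -1, -1, 0, 0], .case3⟩,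
      ⟨![-2, 1, 1, 1, 1, 0, 0, 0], ![-2, 1, 1, 0, 0, 0, 0, 0], .case3⟩,
      ⟨![-2, 1, 1, 1, 1, 0, 0, 0], ![2, 0, 0, -1, -1, 0, 0, 0], .case3⟩,
      ⟨![-1, 0, 0, 1, 0, 0, 0, 0], ![-1, 1, -1, -1, 1, 1, 0, 0], .case4⟩,
      ⟨![0, 1, 0, 1, 0, 0, 0, 0], ![2, 0, 0, 0, 1, 1, 0, 0], .case4⟩,
      ⟨![0, 1, 0, 1, 0, 0, 0, 0], ![-1, 1, -1, -1, 1, 1, 0, 0], .case4⟩,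
      ⟨![-2, 0, -1, 1, 1, 1, 0, 0], ![-2, -1, 0, 0, 0, -1, 0, 0], .case4⟩,
      ⟨![-2, 0, -1, 1, 1, 1, 0, 0], ![-2, 1, 1, 0, 0, 0, 0, 0], .case4⟩,
      ⟨![-2, 0, -1, 1, 1, 1, 0, 0], ![-1, -1, 1, 0, 0, -1, 1, -1], .case4⟩,
      ⟨![-2, 0, -1, 1, 1, 1, 0, 0], ![-1, -1, 1, 0, 0, -1, 1, 1], .case4⟩,
      ⟨![-2, 0, -1, 1, 1, 1, 0, 0], ![-1, -1, 1, 1, 1, 0, 1, 0], .case4⟩,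
      ⟨![-2, 0, -1, 1, 1, 1, 0, 0], ![2, 0, 0, 0, -1, -1, 0, 0], .case4⟩,
      ⟨![-2, 0, -1, 1, 1, 1, 0, 0], ![-1, 1, -1, -1, -1, -1, 0, 0], .case4⟩,
      ⟨![-2, 1, 1, 1, 1, 0, 0, 0], ![-2, 0, -1, 0, 0, 1, 0, 0], .case4⟩,
      ⟨![-2, 1, 1, 1, 1, 0, 0, 0], ![-1, 0, 0, -1, -1, 1, 1, -1], .case4⟩,
      ⟨![-2, 1, 1, 1, 1, 0, 0, 0], ![2, 0, 0, 1, 0, 1, 0, 0], .case4⟩,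
      ⟨![-2, 1, 1, 1, 1, 0, 0, 0], ![-1, 1, -1, -1, -1, 1, 0, 0], .case4⟩,
      ⟨![-2, 1, 1, 1, 1, 0, 0, 0], ![0, -1, -1, 0, -1, 1, 1, 1], .case4⟩]
  | .t8a => [
      ⟨![0, 0, 1, 1, 1, 1, 0, 0], ![0, 0, -1, -1, -1, -1, 1, 1], .case1⟩,
      ⟨![0, 0, 1, 1, 1, 1, 0, 0], ![-1, -2, 0, 0, 0, -1, 0, 0], .case2⟩,
      ⟨![0, 0, 1, 1, 1, 1, 0, 0], ![0, 0, 2, 0, 0, 0, 1, -1], .case2⟩,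
      ⟨![0, 0, 1, 1, 1, 1, 0, 0], ![0, 0, -1, -1, -1, -1, 1, -1], .case3⟩,
      ⟨![0, 0, 1, 1, 1, 1, 0, 0], ![0, 0, 2, 0, 0, 0, 1, 1], .case4⟩]
  | .t8b => [
      ⟨![-1, 0, 0, 0, -1, 1, 1, 0], ![-1, -1, -1, -1, -1, 0, 0, -1], .case2⟩,
      ⟨![-1, 0, 0, 0, -1, 1, 1, 0], ![-1, 1, 1, 1, -1, 0, 0, 1], .case2⟩,
      ⟨![0, 1, 1, 1, 0, 1, 0, 0], ![1, -1, -1, -1, 1, -1, 0, 0], .case2⟩,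
      ⟨![-1, 0, 0, 0, -1, 1, 1, 0], ![-1, 1, 1, 0, 0, -1, -1, 1], .case3⟩,
      ⟨![-1, 0, 0, 0, -1, 1, 1, 0], ![0, 0, -1, -1, -1, -1, -1, -1], .case3⟩,
      ⟨![-1, 1, 1, 0, 0, 1, 0, 0], ![-2, 0, 0, -1, -1, 0, 0, 0], .case3⟩,
      ⟨![-1, 1, 1, 0, 0, 1, 0, 0], ![1, 1, 1, 1, 1, 1, 0, 0], .case3⟩,
      ⟨![-1, 0, 0, 0, -1, 1, 1, 0], ![-2, 0, -1, -1, 0, 0, 0, 0], .case4⟩,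
      ⟨![-1, 0, 0, 0, -1, 1, 1, 0], ![-2, 0, 0, 0, 1, 1, 0, 0], .case4⟩,
      ⟨![-1, 0, 0, 0, -1, 1, 1, 0], ![-2, 1, 0, 0, 0, 0, 0, 1], .case4⟩,
      ⟨![-1, 0, 0, 0, -1, 1, 1, 0], ![-1, 0, -1, -1, 1, 0, -1, 1], .case4⟩,
      ⟨![-1, 0, 0, 0, -1, 1, 1, 0], ![-1, 1, 1, -1, 1, 0, -1, 0], .case4⟩,
      ⟨![-1, 1, 1, 0, 0, 1, 0, 0], ![-2, 1, 0, 0, 0, -1, 0, 0], .case4⟩,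
      ⟨![-1, 1, 1, 0, 0, 1, 0, 0], ![-1, -1, -1, -1, -1, 0, 1, 0], .case4⟩,
      ⟨![-1, 1, 1, 0, 0, 1, 0, 0], ![-1, -1, -1, 1, 0, 0, 1, -1], .case4⟩,
      ⟨![0, 1, 1, 1, 0, 1, 0, 0], ![-2, 0, 0, 0, 1, -1, 0, 0], .case4⟩,
      ⟨![0, 1, 1, 1, 0, 1, 0, 0], ![0, 1, 0, -2, 1, 0, 0, 0], .case4⟩]
  | .t9a => [
      ⟨![1, 0, 1, 0, 0, 0, 0, 0], ![-1, 1, -1, 1, 1, 1, 1, 1], .case1⟩,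
      ⟨![1, 0, 1, 0, 0, 0, 0, 0], ![1, 2, 0, 1, 1, 1, 0, 0], .case2⟩,
      ⟨![-1, -1, 1, 1, 1, 1, 1, -1], ![0, 0, 2, 0, -1, -1, -1, 1], .case2⟩,
      ⟨![-1, -1, 1, 1, 1, 1, 1, -1], ![0, 0, 0, 0, 0, -1, -1, 0], .case3⟩,
      ⟨![-1, -1, 1, 1, 1, 1, 1, -1], ![-1, -2, 1, 0, 0, 0, -1, -1], .case4⟩]
  | .t9b => [
      ⟨![-1, 0, 0, 0, 0, 1, 0, 0], ![-1, 0, 0, 0, -1, 0, 0, 0], .case2⟩,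
      ⟨![0, 1, 0, 0, 0, 1, 0, 0], ![-1, -1, -1, -1, -1, -1, 1, 1], .case2⟩,
      ⟨![-2, 0, 0, 0, -1, 1, 1, 1], ![-1, -1, -1, -1, -1, 1, 1, -1], .case2⟩,
      ⟨![-1, 0, 0, 0, 0, 1, 0, 0], ![-2, 1, 0, 0, 0, -1, 1, -1], .case3⟩,
      ⟨![-2, 0, 0, 0, -1, 1, 1, 1], ![-2, 0, 0, -1, -1, 1, 1, 0], .case3⟩,
      ⟨![-1, 0, 0, 0, 0, 1, 0, 0], ![-2, 0, 0, -1, -1, -1, 1, 0], .case4⟩,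
      ⟨![0, 1, 0, 0, 0, 1, 0, 0], ![-2, -1, 0, 0, -1, -1, 1, 0], .case4⟩,
      ⟨![-2, 0, 0, 0, -1, 1, 1, -1], ![-2, 0, 0, -1, -1, 1, 0, -1], .case4⟩,
      ⟨![-2, 0, 0, 0, -1, 1, 1, -1], ![-2, 1, 0, 0, 0, -1, -1, 1], .case4⟩,
      ⟨![-2, 0, 0, 0, -1, 1, 1, -1], ![-2, 1, 0, 0, 0, 1, 1, -1], .case4⟩,
      ⟨![-2, 0, 0, 0, -1, 1, 1, -1], ![-1, -1, -1, -1, -1, 1, -1, -1], .case4⟩,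
      ⟨![-2, 0, 0, 0, -1, 1, 1, -1], ![-1, 1, 1, -1, 1, -1, -1, 1], .case4⟩,
      ⟨![-2, 0, 0, 0, -1, 1, 1, -1], ![-1, 1, 1, 1, -1, 1, -1, -1], .case4⟩,
      ⟨![-2, 0, 0, 0, -1, 1, 1, -1], ![1, -1, -1, -1, 1, 1, -1, -1], .case4⟩,
      ⟨![-2, 0, 0, 0, -1, 1, 1, -1], ![1, 1, 1, 1, 1, 1, -1, -1], .case4⟩,
      ⟨![-2, 0, 0, 0, -1, 1, 1, 1], ![-2, 0, -1, -1, 0, 1, 0, -1], .case4⟩]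

end HiddenSector

/-! Multiplication by three puts the hidden vectors into Λ, the `E8` lattice, where translations act
by 3Λ; only classes in Λ/3Λ matter. In doubled coordinates Λ has index a power of two in ℤ⁸, so
reducing these coordinates modulo three identifies Λ/3Λ with F₃⁸. Doubled products are four times
the true ones and 4 = 1 in F₃, so the form becomes the standard scalar product and Weyl reflections
become reflections in vectors of norm 2 (`equivalent_of_red_eq`, `exists_equivalent_reflectMod`).
Consistency fixes the Gram matrix of the three classes to be minus the observable one
(`exists_doubled_of_isCompletedBy`).

What remains is to find representatives of triples in F₃⁸ with a given Gram matrix under the Weyl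
group. This is done one vector at a time: the twist is moved by the whole Weyl group, the first
Wilson line by elements fixing the twist, the second by elements fixing both. Each stage is a kernel
computation on 6561 vectors: a search spreads from the proposed representatives along words of
reflections, and a sweep confirms that every vector with the required products was reached
(`exists_word_of_orbitCheck`). The words need only fix the earlier vectors; that they generate the
full stabilizer is never needed. `exists_word_entry` joins the stages, and `exists_equivalent_entry`
lifts the result to embeddings.

Gauge groups are certified by explicit simple roots. Nonsingularity of the Cartan matrix gives
independence, and a run through all roots, recovered from their classes by
`IsDoubledRoot.rootOf_code`, shows that the unbroken ones are combinations of one sign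
(`hasCase_hidden`). The gauge group is invariant under equivalence (`HasCase.of_equivalent`), so an
embedding not of Case 5 cannot be equivalent to one of the 17 added entries; completeness of the
displayed tables follows from that of the extended ones. -/

namespace HiddenSector

/-! ### Doubled coordinates on the root lattice -/

/-- `y` is twice a vector of the `E8` lattice. -/
def IsDoubled (y : Fin 8 → ℤ) : Prop :=
  4 ∣ ∑ i, y i ∧ ∀ i, 2 ∣ y i - y 0

instance (y : Fin 8 → ℤ) : Decidable (IsDoubled y) := by
  unfold IsDoubled; infer_instance

/-- The vector with doubled coordinates `y`. -/
noncomputable def half (y : Fin 8 → ℤ) : Fin 8 → ℝ := fun i => (y i : ℝ) / 2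

/-- The integral and half-integral vectors are y = 2n and y = 2n + 1. In the second case the eight
units add 8 to the coordinate sum, which is 0 modulo 4, so the parity condition reads the same for
both. -/
theorem mem_e8Lattice_iff {x : Fin 8 → ℝ} :
    x ∈ e8Lattice ↔ ∃ y, IsDoubled y ∧ x = half y := by
  constructor
  · rintro ⟨n, hn, h | h⟩
    · refine ⟨fun i => 2 * n i, ⟨?_, fun i => ⟨n i - n 0, by ring⟩⟩, ?_⟩
      · rw [← Finset.mul_sum]
        obtain ⟨k, hk⟩ := hn
        exact ⟨k, by rw [hk]; ring⟩
      · ext i; simp [half, h i]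
    · refine ⟨fun i => 2 * n i + 1, ⟨?_, fun i => ⟨n i - n 0, by ring⟩⟩, ?_⟩
      · rw [Finset.sum_add_distrib, ← Finset.mul_sum]
        obtain ⟨k, hk⟩ := hn
        exact ⟨k + 2, by rw [hk]; simp; ring⟩
      · ext i; simp [half, h i]; ring
  · rintro ⟨y, ⟨⟨k, hk⟩, hp⟩, rfl⟩
    choose m hm using hp
    have hy : ∀ i, y i = y 0 + 2 * m i := fun i => by linarith [hm i]
    obtain ⟨a, ha | ha⟩ := Int.even_or_odd' (y 0)
    · refine ⟨fun i => a + m i, ?_, Or.inl fun i => ?_⟩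
      · refine ⟨k, ?_⟩
        have : ∑ i, y i = 2 * ∑ i, (a + m i) := by
          rw [Finset.mul_sum]
          exact Finset.sum_congr rfl fun i _ => by rw [hy i, ha]; ring
        linarith
      · simp [half, hy i, ha]; ring
    · refine ⟨fun i => a + m i, ?_, Or.inr fun i => ?_⟩
      · refine ⟨k - 2, ?_⟩
        have : ∑ i, y i = 2 * (∑ i, (a + m i)) + 8 := by
          have e : ∀ i, y i = 2 * (a + m i) + 1 := fun i => by rw [hy i, ha]; ring
          rw [Finset.sum_congr rfl fun i _ => e i, Finset.sum_add_distrib, ← Finset.mul_sum]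
          simp
        linarith
      · simp [half, hy i, ha]; ring

theorem half_dotProduct (y z : Fin 8 → ℤ) : half y ⬝ᵥ half z = ((y ⬝ᵥ z : ℤ) : ℝ) / 4 := by
  simp only [half, dotProduct, Int.cast_sum, Int.cast_mul, Finset.sum_div]
  exact Finset.sum_congr rfl fun i _ => by ring

/-- Integrality of the `E8` form. Writing y = y₀ + 2m and z = z₀ + 2n, the product expands into
multiples of the two coordinate sums and explicit multiples of 4. -/
theorem IsDoubled.four_dvd_dotProduct {y z : Fin 8 → ℤ} (hy : IsDoubled y) (hz : IsDoubled z) :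
    4 ∣ y ⬝ᵥ z := by
  obtain ⟨⟨k, hk⟩, hp⟩ := hy
  obtain ⟨⟨l, hl⟩, hq⟩ := hz
  choose m hm using hp
  choose n hn using hq
  have h1 : ∀ i, y i = y 0 + 2 * m i := fun i => by linarith [hm i]
  have h2 : ∀ i, z i = z 0 + 2 * n i := fun i => by linarith [hn i]
  have e : y ⬝ᵥ z = y 0 * (∑ i, z i) + z 0 * (∑ i, y i) - 8 * (y 0 * z 0) +
      4 * ∑ i, m i * n i := by
    simp only [dotProduct, Fin.sum_univ_eight]
    simp only [h1 1, h1 2, h1 3, h1 4, h1 5, h1 6, h1 7, h2 1, h2 2, h2 3, h2 4, h2 5, h2 6, h2 7]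
    have a0 : m 0 = 0 := by linarith [h1 0]
    have b0 : n 0 = 0 := by linarith [h2 0]
    rw [a0, b0]; ring
  rw [e, hk, hl]
  exact ⟨y 0 * l + z 0 * k - 2 * (y 0 * z 0) + ∑ i, m i * n i, by ring⟩

theorem IsDoubled.add {y z : Fin 8 → ℤ} (hy : IsDoubled y) (hz : IsDoubled z) :
    IsDoubled (y + z) := by
  refine ⟨?_, fun i => ?_⟩
  · simpa [Finset.sum_add_distrib] using dvd_add hy.1 hz.1
  · have := dvd_add (hy.2 i) (hz.2 i)
    rwa [← add_sub_add_comm] at this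

theorem IsDoubled.zsmul {y : Fin 8 → ℤ} (hy : IsDoubled y) (k : ℤ) : IsDoubled (k • y) := by
  refine ⟨?_, fun i => ?_⟩
  · simpa [← Finset.mul_sum] using hy.1.mul_left k
  · have := (hy.2 i).mul_left k
    rwa [mul_sub] at this

theorem IsDoubled.sub {y z : Fin 8 → ℤ} (hy : IsDoubled y) (hz : IsDoubled z) :
    IsDoubled (y - z) := by
  simpa [sub_eq_add_neg] using hy.add (hz.zsmul (-1))

/-- Doubled coordinates of a root. -/
def IsDoubledRoot (y : Fin 8 → ℤ) : Prop := IsDoubled y ∧ y ⬝ᵥ y = 8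

instance (y : Fin 8 → ℤ) : Decidable (IsDoubledRoot y) := by
  unfold IsDoubledRoot; infer_instance

theorem mem_e8Roots_iff {e : Fin 8 → ℝ} :
    e ∈ e8Roots ↔ ∃ y, IsDoubledRoot y ∧ e = half y := by
  constructor
  · rintro ⟨h, h2⟩
    obtain ⟨y, hy, rfl⟩ := mem_e8Lattice_iff.1 h
    refine ⟨y, ⟨hy, ?_⟩, rfl⟩
    rw [half_dotProduct] at h2
    have : ((y ⬝ᵥ y : ℤ) : ℝ) = ((8 : ℤ) : ℝ) := by push_cast; linarith
    exact_mod_cast this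
  · rintro ⟨y, ⟨hy, h8⟩, rfl⟩
    refine ⟨mem_e8Lattice_iff.2 ⟨y, hy, rfl⟩, ?_⟩
    rw [half_dotProduct, h8]; norm_num

theorem exists_int_dotProduct {x z : Fin 8 → ℝ} (hx : x ∈ e8Lattice) (hz : z ∈ e8Lattice) :
    ∃ k : ℤ, x ⬝ᵥ z = k := by
  obtain ⟨y, hy, rfl⟩ := mem_e8Lattice_iff.1 hx
  obtain ⟨w, hw, rfl⟩ := mem_e8Lattice_iff.1 hz
  obtain ⟨k, hk⟩ := hy.four_dvd_dotProduct hw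
  exact ⟨k, by rw [half_dotProduct, hk]; push_cast; ring⟩

/-! ### Equivalence in terms of doubled coordinates -/

/-- The embedding whose vectors, multiplied by six, are `y`. -/
noncomputable def ofDoubled (y : Fin 3 → Fin 8 → ℤ) : Embedding (Fin 8) :=
  fun p i => (y p i : ℝ) / 6

theorem equivalent_translate (E : Embedding (Fin 8)) (l : Fin 3 → Fin 8 → ℝ)
    (hl : ∀ p, l p ∈ e8Lattice) : Equivalent E (fun p => E p + l p) := by
  have h1 := Operation.translate E 0 (l 0) (hl 0)
  have h2 := Operation.translate (Function.update E 0 (E 0 + l 0)) 1 (l 1) (hl 1)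
  have h3 := Operation.translate (Function.update (Function.update E 0
    (E 0 + l 0)) 1 (Function.update E 0 (E 0 + l 0) 1 + l 1)) 2 (l 2) (hl 2)
  refine ((Relation.ReflTransGen.single h1).tail h2).tail ?_
  convert h3 using 1
  ext p i
  fin_cases p <;> simp [Function.update]

/-- The class modulo three of a vector in doubled coordinates. -/
def red (y : Fin 8 → ℤ) : Fin 8 → ZMod 3 := fun i => (y i : ZMod 3)

theorem red_dotProduct (y z : Fin 8 → ℤ) : red y ⬝ᵥ red z = ((y ⬝ᵥ z : ℤ) : ZMod 3) := by
  simp [red, dotProduct]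

/-- If z - y = 3d coordinatewise, then d inherits the divisibility conditions of z - y, because 3 is
coprime to 2 and 4. Hence d/2 is a lattice vector, and it is exactly the translation needed: 3d/6 =
d/2. -/
theorem equivalent_of_red_eq {y z : Fin 3 → Fin 8 → ℤ} (hy : ∀ p, IsDoubled (y p))
    (hz : ∀ p, IsDoubled (z p)) (h : ∀ p, red (y p) = red (z p)) :
    Equivalent (ofDoubled y) (ofDoubled z) := by
  have h3 : ∀ p i, (3 : ℤ) ∣ z p i - y p i := fun p i => by
    have := congrFun (h p) i
    exact (ZMod.intCast_eq_intCast_iff_dvd_sub _ _ 3).1 this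
  choose d hd using h3
  have hl : ∀ p, half (d p) ∈ e8Lattice := fun p => by
    refine mem_e8Lattice_iff.2 ⟨d p, ⟨?_, fun i => ?_⟩, rfl⟩
    · have h4 : 4 ∣ ∑ i, (z p i - y p i) := ((hz p).sub (hy p)).1
      simp only [hd, ← Finset.mul_sum] at h4
      exact (show IsCoprime (4 : ℤ) 3 by norm_num).dvd_of_dvd_mul_left h4
    · have h2 := ((hz p).sub (hy p)).2 i
      simp only [Pi.sub_apply, hd, ← mul_sub] at h2
      exact (show IsCoprime (2 : ℤ) 3 by norm_num).dvd_of_dvd_mul_left h2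
  convert equivalent_translate (ofDoubled y) (fun p => half (d p)) hl using 1
  ext p i
  have : (z p i : ℝ) = y p i + 3 * d p i := by
    have := hd p i
    have : z p i = y p i + 3 * d p i := by linarith
    rw [this]; push_cast; ring
  simp only [ofDoubled, half, Pi.add_apply, this]; ring

/-- The reflection in a root modulo three. -/
def reflectMod (e v : Fin 8 → ZMod 3) : Fin 8 → ZMod 3 := v - (v ⬝ᵥ e) • e

/-- With y · r = 4k, the Weyl reflection subtracts k r from y. Modulo three k = 4k = y · r, so no
rescaling is needed in passing to classes. -/
theorem exists_equivalent_reflectMod {y : Fin 3 → Fin 8 → ℤ} (hy : ∀ p, IsDoubled (y p))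
    {r : Fin 8 → ℤ} (hr : IsDoubledRoot r) :
    ∃ z : Fin 3 → Fin 8 → ℤ, (∀ p, IsDoubled (z p)) ∧ Equivalent (ofDoubled y) (ofDoubled z) ∧
      ∀ p, red (z p) = reflectMod (red r) (red (y p)) := by
  have h4 := fun p => (hy p).four_dvd_dotProduct hr.1
  choose k hk using h4
  refine ⟨fun p => y p - k p • r, fun p => (hy p).sub (hr.1.zsmul _), ?_, fun p => ?_⟩
  · have := Operation.reflect (ofDoubled y) (half r) (mem_e8Roots_iff.2 ⟨r, hr, rfl⟩)
    refine Relation.ReflTransGen.single ?_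
    convert this using 1
    ext p i
    have h : ofDoubled y p ⬝ᵥ half r = (k p : ℝ) / 3 := by
      have : ofDoubled y p ⬝ᵥ half r = ((y p ⬝ᵥ r : ℤ) : ℝ) / 12 := by
        simp only [ofDoubled, half, dotProduct, Int.cast_sum, Int.cast_mul, Finset.sum_div]
        exact Finset.sum_congr rfl fun i _ => by ring
      rw [this, hk]; push_cast; ring
    simp only [weylReflection, h, Pi.sub_apply, Pi.smul_apply, smul_eq_mul, ofDoubled, half]
    push_cast; ring
  · ext i
    have h : red (y p) ⬝ᵥ red r = (k p : ZMod 3) := by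
      rw [red_dotProduct, hk]
      push_cast
      rw [show (4 : ZMod 3) = 1 from rfl, one_mul]
    simp only [reflectMod, h, Pi.sub_apply, Pi.smul_apply, smul_eq_mul, red]
    push_cast; ring

theorem reflectMod_dotProduct {e : Fin 8 → ZMod 3} (he : e ⬝ᵥ e = 2) (u v : Fin 8 → ZMod 3) :
    reflectMod e u ⬝ᵥ reflectMod e v = u ⬝ᵥ v := by
  simp only [reflectMod, sub_dotProduct, dotProduct_sub, smul_dotProduct, dotProduct_smul, he,
    smul_eq_mul, dotProduct_comm e v]
  ring

theorem reflectMod_reflectMod {e : Fin 8 → ZMod 3} (he : e ⬝ᵥ e = 2) (v : Fin 8 → ZMod 3) :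
    reflectMod e (reflectMod e v) = v := by
  ext i
  simp only [reflectMod, sub_dotProduct, smul_dotProduct, he, smul_eq_mul, Pi.sub_apply,
    Pi.smul_apply]
  ring

/-! ### Vectors modulo three coded by natural numbers -/

/-- The vector whose coordinates are the ternary digits of `n`. -/
def vec (n : ℕ) : Fin 8 → ZMod 3 := fun i => ((n / 3 ^ (i : ℕ) : ℕ) : ZMod 3)

/-- The number whose ternary digits are given by the vector `v`. -/
def code (v : Fin 8 → ZMod 3) : ℕ :=
  (v 0).val + 3 * (v 1).val + 9 * (v 2).val + 27 * (v 3).val + 81 * (v 4).val +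
    243 * (v 5).val + 729 * (v 6).val + 2187 * (v 7).val

/-- `f n`, arranged so that the kernel evaluates `n` before unfolding `f`. -/
noncomputable def force {α : Type} (n : ℕ) (f : ℕ → α) : α :=
  Nat.rec (f 0) (fun k _ => f k.succ) n

theorem force_eq {α : Type} (n : ℕ) (f : ℕ → α) : force n f = f n := by
  cases n <;> rfl

theorem ternary_digits (d : Fin 8 → ℕ) (hd : ∀ i, d i < 3) :
    vec (d 0 + 3 * d 1 + 9 * d 2 + 27 * d 3 + 81 * d 4 + 243 * d 5 + 729 * d 6 + 2187 * d 7) =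
      fun i => (d i : ZMod 3) := by
  have h0 := hd 0
  have h1 := hd 1
  have h2 := hd 2
  have h3 := hd 3
  have h4 := hd 4
  have h5 := hd 5
  have h6 := hd 6
  have h7 := hd 7
  ext i
  rw [vec, ZMod.natCast_eq_natCast_iff']
  fin_cases i <;> simp <;> omega

theorem code_lt (v : Fin 8 → ZMod 3) : code v < 6561 := by
  have h : ∀ i, (v i).val < 3 := fun i => ZMod.val_lt _
  have h0 := h 0
  have h1 := h 1
  have h2 := h 2
  have h3 := h 3
  have h4 := h 4
  have h5 := h 5
  have h6 := h 6
  have h7 := h 7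
  unfold code; omega

theorem vec_code (v : Fin 8 → ZMod 3) : vec (code v) = v := by
  rw [code, ternary_digits (fun i => (v i).val) fun i => ZMod.val_lt _]
  ext i; simp

/-- The scalar product modulo three of coded vectors, in terms of the operations that the kernel
evaluates directly. -/
def dotCode (m n : ℕ) : ℕ :=
  let d (p : ℕ) := Nat.mul (Nat.mod (Nat.div m p) 3) (Nat.mod (Nat.div n p) 3)
  Nat.mod (Nat.add (Nat.add (Nat.add (d 1) (d 3)) (Nat.add (d 9) (d 27)))
    (Nat.add (Nat.add (d 81) (d 243)) (Nat.add (d 729) (d 2187)))) 3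

theorem dotCode_def (m n : ℕ) : dotCode m n =
    ((m / 1 % 3 * (n / 1 % 3) + m / 3 % 3 * (n / 3 % 3) +
      (m / 9 % 3 * (n / 9 % 3) + m / 27 % 3 * (n / 27 % 3))) +
    (m / 81 % 3 * (n / 81 % 3) + m / 243 % 3 * (n / 243 % 3) +
      (m / 729 % 3 * (n / 729 % 3) + m / 2187 % 3 * (n / 2187 % 3)))) % 3 :=
  rfl

theorem dotCode_cast (m n : ℕ) : (dotCode m n : ZMod 3) = vec m ⬝ᵥ vec n := by
  simp only [dotCode_def, vec, dotProduct, Fin.sum_univ_eight, ZMod.natCast_mod, Nat.cast_add,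
    Nat.cast_mul]
  simp only [Fin.coe_ofNat_eq_mod]
  norm_num
  ring

theorem dotCode_eq_iff (m n c : ℕ) : dotCode m n = c % 3 ↔ vec m ⬝ᵥ vec n = (c : ZMod 3) := by
  rw [← dotCode_cast, ZMod.natCast_eq_natCast_iff']
  simp [dotCode_def]

/-- The sum of the coded vector `n` and `k` times the coded vector `r`. -/
def addCode (k r n : ℕ) : ℕ :=
  let d (p acc : ℕ) :=
    Nat.add acc (Nat.mul p (Nat.mod (Nat.add (Nat.div n p) (Nat.mul k (Nat.div r p))) 3))
  d 2187 (d 729 (d 243 (d 81 (d 27 (d 9 (d 3 (d 1 0)))))))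

theorem addCode_def (k r n : ℕ) : addCode k r n =
    0 + 1 * ((n / 1 + k * (r / 1)) % 3) + 3 * ((n / 3 + k * (r / 3)) % 3) +
    9 * ((n / 9 + k * (r / 9)) % 3) + 27 * ((n / 27 + k * (r / 27)) % 3) +
    81 * ((n / 81 + k * (r / 81)) % 3) + 243 * ((n / 243 + k * (r / 243)) % 3) +
    729 * ((n / 729 + k * (r / 729)) % 3) + 2187 * ((n / 2187 + k * (r / 2187)) % 3) :=
  rfl

theorem vec_addCode (k r n : ℕ) : vec (addCode k r n) = vec n + (k : ZMod 3) • vec r := by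
  have h := ternary_digits (fun i => (n / 3 ^ (i : ℕ) + k * (r / 3 ^ (i : ℕ))) % 3)
    fun i => Nat.mod_lt _ (by norm_num)
  simp only [Fin.val_zero, Fin.val_one, Fin.val_two, pow_zero, pow_one] at h
  rw [addCode_def, zero_add, one_mul]
  refine Eq.trans h ?_
  ext i
  simp [vec]

/-- The reflection of the coded vector `n` in the coded root `r`. -/
noncomputable def reflectCode (r n : ℕ) : ℕ :=
  force (dotCode r n) fun k => Nat.rec n (fun j _ => addCode (Nat.mul 2 j.succ) r n) k

/-- Codes cannot be subtracted, so k times the root is removed by adding 2k times it, as 2 = -1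
modulo three. -/
theorem vec_reflectCode (r n : ℕ) : vec (reflectCode r n) = reflectMod (vec r) (vec n) := by
  have h : ∀ k : ℕ, vec (Nat.rec n (fun j _ => addCode (Nat.mul 2 j.succ) r n) k : ℕ) =
      vec n - (k : ZMod 3) • vec r := by
    rintro (_ | j)
    · simp
    · refine (vec_addCode _ _ _).trans ?_
      rw [Nat.mul_eq, Nat.cast_mul, show ((2 : ℕ) : ZMod 3) = -1 from rfl, neg_one_mul, neg_smul,
        sub_eq_add_neg]
  rw [reflectCode, force_eq, h, dotCode_cast, reflectMod, dotProduct_comm]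

/-- The lift of a ternary digit to `{-1, 0, 1}`. -/
def centered : ℕ → ℤ
  | 0 => 0
  | 1 => 1
  | _ => -1

/-- The doubled coordinates of the root with class `n`. -/
def rootOf (n : ℕ) (i : Fin 8) : ℤ :=
  if n % 3 * (n / 3 % 3) * (n / 9 % 3) * (n / 27 % 3) * (n / 81 % 3) * (n / 243 % 3) *
      (n / 729 % 3) * (n / 2187 % 3) = 0 then
    -2 * centered (n / 3 ^ (i : ℕ) % 3)
  else centered (n / 3 ^ (i : ℕ) % 3)

theorem centered_cast (n : ℕ) : ((centered (n % 3) : ℤ) : ZMod 3) = n := by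
  rw [← ZMod.natCast_mod n 3]
  have : n % 3 < 3 := Nat.mod_lt _ (by norm_num)
  interval_cases n % 3 <;> decide

/-- The factor -2 in the integral case is 1 modulo three, so both shapes of root have the class they
are decoded from. -/
theorem red_rootOf (n : ℕ) : red (rootOf n) = vec n := by
  ext i
  simp only [red, rootOf, vec]
  split_ifs
  · rw [Int.cast_mul, centered_cast, show ((-2 : ℤ) : ZMod 3) = 1 from rfl, one_mul]
  · exact centered_cast _

/-- Whether `n` is the class of a root. -/
def isRoot (n : ℕ) : Bool := decide (IsDoubledRoot (rootOf n))

theorem isDoubledRoot_rootOf {n : ℕ} (h : isRoot n = true) : IsDoubledRoot (rootOf n) :=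
  of_decide_eq_true h

theorem vec_dotProduct_self {n : ℕ} (h : isRoot n = true) : vec n ⬝ᵥ vec n = 2 := by
  rw [← red_rootOf, red_dotProduct, (isDoubledRoot_rootOf h).2]
  rfl

/-! ### Words of reflections -/

/-- The action of a word of coded roots on a vector. -/
def act (w : List ℕ) (v : Fin 8 → ZMod 3) : Fin 8 → ZMod 3 :=
  w.foldl (fun v r => reflectMod (vec r) v) v

/-- The action of a word of coded roots on a coded vector. -/
noncomputable def actCode (w : List ℕ) : ℕ → ℕ :=
  List.rec (fun n => n) (fun r _ ih n => ih (reflectCode r n)) w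

/-- All letters of the word are classes of roots. -/
def IsWord (w : List ℕ) : Prop := ∀ r ∈ w, isRoot r = true

theorem vec_actCode (w : List ℕ) (n : ℕ) : vec (actCode w n) = act w (vec n) := by
  induction w generalizing n with
  | nil => rfl
  | cons r w ih =>
    change vec (actCode w (reflectCode r n)) = act w (reflectMod (vec r) (vec n))
    rw [ih, vec_reflectCode]

theorem act_append (w w' : List ℕ) (v : Fin 8 → ZMod 3) : act (w ++ w') v = act w' (act w v) := by
  simp [act]

theorem IsWord.append {w w' : List ℕ} (h : IsWord w) (h' : IsWord w') : IsWord (w ++ w') := by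
  intro r hr
  rcases List.mem_append.1 hr with hr | hr
  exacts [h r hr, h' r hr]

theorem IsWord.reverse {w : List ℕ} (h : IsWord w) : IsWord w.reverse :=
  fun r hr => h r (List.mem_reverse.1 hr)

theorem IsWord.act_reverse {w : List ℕ} (h : IsWord w) (v : Fin 8 → ZMod 3) :
    act w.reverse (act w v) = v := by
  induction w generalizing v with
  | nil => rfl
  | cons r w ih =>
    have hw : IsWord w := fun s hs => h s (List.mem_cons_of_mem _ hs)
    rw [List.reverse_cons, act_append]
    have : act (r :: w) v = act w (reflectMod (vec r) v) := rfl
    rw [this, ih hw]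
    exact reflectMod_reflectMod (vec_dotProduct_self (h r List.mem_cons_self)) v

/-- This keeps the Gram conditions available after each stage of moving a triple. -/
theorem IsWord.act_dotProduct {w : List ℕ} (h : IsWord w) (u v : Fin 8 → ZMod 3) :
    act w u ⬝ᵥ act w v = u ⬝ᵥ v := by
  induction w generalizing u v with
  | nil => rfl
  | cons r w ih =>
    have hw : IsWord w := fun s hs => h s (List.mem_cons_of_mem _ hs)
    have : ∀ v, act (r :: w) v = act w (reflectMod (vec r) v) := fun _ => rfl
    rw [this, this, ih hw, reflectMod_dotProduct (vec_dotProduct_self (h r List.mem_cons_self))]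

theorem IsWord.exists_equivalent {w : List ℕ} (hw : IsWord w) {y : Fin 3 → Fin 8 → ℤ}
    (hy : ∀ p, IsDoubled (y p)) :
    ∃ z : Fin 3 → Fin 8 → ℤ, (∀ p, IsDoubled (z p)) ∧ Equivalent (ofDoubled y) (ofDoubled z) ∧
      ∀ p, red (z p) = act w (red (y p)) := by
  induction w generalizing y with
  | nil => exact ⟨y, hy, Relation.ReflTransGen.refl, fun _ => rfl⟩
  | cons r w ih =>
    obtain ⟨z, hz, e, h⟩ :=
      exists_equivalent_reflectMod hy (isDoubledRoot_rootOf (hw r List.mem_cons_self))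
    obtain ⟨z', hz', e', h'⟩ := ih (fun s hs => hw s (List.mem_cons_of_mem _ hs)) hz
    refine ⟨z', hz', Relation.ReflTransGen.trans e e', fun p => ?_⟩
    rw [h', h, red_rootOf]; rfl

/-! ### Orbits by exhaustive search -/

/-- The set, as a bit mask, of the coded vectors reached by a search with the generators `gens`:
`gs` are the generators still to be applied to `x`, `todo` are the vectors still to be expanded and
`vis` is the set reached so far. -/
noncomputable def search (gens : List (List ℕ)) (fuel : ℕ) :
    List (List ℕ) → ℕ → List ℕ → ℕ → ℕ :=
  Nat.rec (fun _ _ _ vis => vis) (fun _ ih gs x todo vis =>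
    List.rec (List.rec vis (fun y todo _ => ih gens y todo vis) todo)
      (fun g gs _ => force (actCode g x) fun y =>
        Nat.rec (force (Nat.lor vis (Nat.shiftLeft 1 y)) fun v => ih gs x (y :: todo) v)
          (fun _ _ => ih gs x todo vis) (Nat.land 1 (Nat.shiftRight vis y))) gs) fuel

theorem search_nil_nil (gens : List (List ℕ)) (f x vis : ℕ) :
    search gens (f + 1) [] x [] vis = vis := rfl

theorem search_nil_cons (gens : List (List ℕ)) (f x y : ℕ) (todo : List ℕ) (vis : ℕ) :
    search gens (f + 1) [] x (y :: todo) vis = search gens f gens y todo vis := rfl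

/-- The outcome of the bit test is deliberately forgotten: skipping an old vector and recording a
new one are both harmless for soundness. -/
theorem search_cons (gens : List (List ℕ)) (f : ℕ) (g : List ℕ) (gs : List (List ℕ)) (x : ℕ)
    (todo : List ℕ) (vis : ℕ) :
    search gens (f + 1) (g :: gs) x todo vis = search gens f gs x todo vis ∨
      search gens (f + 1) (g :: gs) x todo vis =
        search gens f gs x (actCode g x :: todo) (vis ||| 1 <<< actCode g x) := by
  have h : search gens (f + 1) (g :: gs) x todo vis = force (actCode g x) fun y =>
    Nat.rec (force (Nat.lor vis (Nat.shiftLeft 1 y)) fun v => search gens f gs x (y :: todo) v)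
      (fun _ _ => search gens f gs x todo vis) (Nat.land 1 (Nat.shiftRight vis y)) := rfl
  rw [force_eq] at h
  cases hb : Nat.land 1 (Nat.shiftRight vis (actCode g x)) with
  | zero =>
    rw [hb] at h
    exact Or.inr (h.trans (force_eq _ _))
  | succ k =>
    rw [hb] at h
    exact Or.inl h

theorem testBit_lor_one_shiftLeft {v y n : ℕ} (h : (v ||| 1 <<< y).testBit n = true) :
    v.testBit n = true ∨ n = y := by
  rw [Nat.testBit_or, Bool.or_eq_true] at h
  refine h.imp_right fun h => ?_
  rw [Nat.one_shiftLeft, Nat.testBit_two_pow] at h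
  exact (of_decide_eq_true h).symm

/-- Only soundness of the search is needed. Insufficient fuel would give a smaller mask and make the
subsequent sweep fail, never a wrong conclusion. -/
theorem search_sound {gens : List (List ℕ)} {P : ℕ → Prop}
    (hP : ∀ g ∈ gens, ∀ x, P x → P (actCode g x)) (f : ℕ) :
    ∀ (gs : List (List ℕ)) (x : ℕ) (todo : List ℕ) (vis : ℕ), gs ⊆ gens → (gs ≠ [] → P x) →
      (∀ y ∈ todo, P y) → (∀ n, vis.testBit n = true → P n) →
      ∀ n, (search gens f gs x todo vis).testBit n = true → P n := by
  induction f with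
  | zero => intro gs x todo vis _ _ _ hv; exact hv
  | succ f ih =>
    intro gs x todo vis hg hx ht hv
    match gs, todo with
    | [], [] => rwa [search_nil_nil]
    | [], y :: todo =>
      rw [search_nil_cons]
      exact ih gens y todo vis (List.Subset.refl _) (fun _ => ht y List.mem_cons_self)
        (fun z hz => ht z (List.mem_cons_of_mem _ hz)) hv
    | g :: gs, todo =>
      have hx' := hx (List.cons_ne_nil _ _)
      have hgs : gs ⊆ gens := fun a ha => hg (List.mem_cons_of_mem _ ha)
      have hy := hP g (hg List.mem_cons_self) x hx'
      rcases search_cons gens f g gs x todo vis with e | e <;> rw [e]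
      · exact ih gs x todo vis hgs (fun _ => hx') ht hv
      · refine ih gs x _ _ hgs (fun _ => hx') ?_ ?_
        · intro z hz
          rcases List.mem_cons.1 hz with rfl | hz
          exacts [hy, ht z hz]
        · intro n hn
          rcases testBit_lor_one_shiftLeft hn with hn | rfl
          exacts [hv n hn, hy]

/-- The bit mask of a list of numbers. -/
def bitMask (l : List ℕ) : ℕ := l.foldr (fun r v => v ||| 1 <<< r) 0

theorem mem_of_testBit_bitMask {l : List ℕ} {n : ℕ} (h : (bitMask l).testBit n = true) :
    n ∈ l := by
  induction l with
  | nil => simp [bitMask] at h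
  | cons r l ih =>
    rcases testBit_lor_one_shiftLeft h with h | rfl
    exacts [List.mem_cons_of_mem _ (ih h), List.mem_cons_self]

/-- Whether `good n s x y` holds for all `n = 3 ^ k * m + ∑ dᵢ 3 ^ i`, where `k` is the length of
`l`, the `dᵢ` are ternary digits and `s`, `x`, `y` are the given numbers, increased modulo three by
the sum of the squares of the digits and by their scalar products with the two components of `l`. -/
noncomputable def sweep (good : ℕ → ℕ → ℕ → ℕ → Bool) (l : List (ℕ × ℕ)) :
    ℕ → ℕ → ℕ → ℕ → Bool :=
  List.rec good (fun pq _ ih m s x y => force (Nat.mul 3 m) fun n =>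
    ih n s x y && ih (Nat.add n 1) (Nat.add s 1) (Nat.add x pq.1) (Nat.add y pq.2) &&
      ih (Nat.add n 2) (Nat.add s 1) (Nat.add x (Nat.mul 2 pq.1)) (Nat.add y (Nat.mul 2 pq.2))) l

theorem sweep_cons (good : ℕ → ℕ → ℕ → ℕ → Bool) (pq : ℕ × ℕ) (l : List (ℕ × ℕ)) (m s x y : ℕ) :
    sweep good (pq :: l) m s x y =
      (sweep good l (3 * m) s x y && sweep good l (3 * m + 1) (s + 1) (x + pq.1) (y + pq.2) &&
        sweep good l (3 * m + 2) (s + 1) (x + 2 * pq.1) (y + 2 * pq.2)) :=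
  force_eq (3 * m) fun n => (sweep good l n s x y &&
    sweep good l (n + 1) (s + 1) (x + pq.1) (y + pq.2) &&
      sweep good l (n + 2) (s + 1) (x + 2 * pq.1) (y + 2 * pq.2))

/-- Follows the branch of one digit. The counters matter only modulo three, so their classes are
named by s', x', y'; iterating then builds the scalar products term by term. -/
theorem sweep_digit {good : ℕ → ℕ → ℕ → ℕ → Bool} {pq : ℕ × ℕ} {l : List (ℕ × ℕ)} {m s x y : ℕ}
    (h : sweep good (pq :: l) m s x y = true) (d : ZMod 3) {s' x' y' : ZMod 3}
    (hs : (s : ZMod 3) = s') (hx : (x : ZMod 3) = x') (hy : (y : ZMod 3) = y') :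
    ∃ s₁ x₁ y₁ : ℕ, sweep good l (3 * m + d.val) s₁ x₁ y₁ = true ∧
      (s₁ : ZMod 3) = s' + d * d ∧ (x₁ : ZMod 3) = x' + d * pq.1 ∧
        (y₁ : ZMod 3) = y' + d * pq.2 := by
  subst hs hx hy
  rw [sweep_cons, Bool.and_eq_true, Bool.and_eq_true] at h
  obtain ⟨⟨h0, h1⟩, h2⟩ := h
  have : d = 0 ∨ d = 1 ∨ d = 2 := by revert d; decide
  rcases this with rfl | rfl | rfl
  · exact ⟨_, _, _, h0, by simp, by simp, by simp⟩
  · exact ⟨_, _, _, h1, by simp, by simp, by simp⟩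
  · refine ⟨_, _, _, h2, ?_, by simp, by simp⟩
    -- The digit 2 raises the norm counter by 1, not 4, since the two agree modulo three.
    rw [show (2 * 2 : ZMod 3) = 1 from rfl]; simp

/-- The ternary digits of `v` and `a`, in decreasing order. -/
def digitPairs (v a : ℕ) : List (ℕ × ℕ) :=
  [2187, 729, 243, 81, 27, 9, 3, 1].map fun p => (Nat.mod (Nat.div v p) 3, Nat.mod (Nat.div a p) 3)

theorem sweep_digitPairs {good : ℕ → ℕ → ℕ → ℕ → Bool} {v a : ℕ}
    (h : sweep good (digitPairs v a) 0 0 0 0 = true) (u : Fin 8 → ZMod 3) :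
    ∃ s x y : ℕ, good (code u) s x y = true ∧ (s : ZMod 3) = u ⬝ᵥ u ∧
      (x : ZMod 3) = u ⬝ᵥ vec v ∧ (y : ZMod 3) = u ⬝ᵥ vec a := by
  -- The code is assembled by Horner's rule, so the highest digit comes first.
  obtain ⟨_, _, _, h, hs, hx, hy⟩ := sweep_digit h (u 7) Nat.cast_zero Nat.cast_zero Nat.cast_zero
  obtain ⟨_, _, _, h, hs, hx, hy⟩ := sweep_digit h (u 6) hs hx hy
  obtain ⟨_, _, _, h, hs, hx, hy⟩ := sweep_digit h (u 5) hs hx hy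
  obtain ⟨_, _, _, h, hs, hx, hy⟩ := sweep_digit h (u 4) hs hx hy
  obtain ⟨_, _, _, h, hs, hx, hy⟩ := sweep_digit h (u 3) hs hx hy
  obtain ⟨_, _, _, h, hs, hx, hy⟩ := sweep_digit h (u 2) hs hx hy
  obtain ⟨_, _, _, h, hs, hx, hy⟩ := sweep_digit h (u 1) hs hx hy
  obtain ⟨s, x, y, h, hs, hx, hy⟩ := sweep_digit h (u 0) hs hx hy
  have hc : ∀ (w p : ℕ), ((Nat.mod (Nat.div w p) 3 : ℕ) : ZMod 3) = ((w / p : ℕ) : ZMod 3) :=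
    fun w p => ZMod.natCast_mod _ 3
  simp only [hc] at hx hy
  refine ⟨s, x, y, ?_, ?_, ?_, ?_⟩
  · convert h using 1
    change _ = good _ _ _ _
    congr 1
    rw [code]; ring
  · rw [hs]; simp only [dotProduct, Fin.sum_univ_eight]; ring
  · rw [hx]; simp only [dotProduct, Fin.sum_univ_eight, vec, Fin.coe_ofNat_eq_mod]; norm_num; ring
  · rw [hy]; simp only [dotProduct, Fin.sum_univ_eight, vec, Fin.coe_ofNat_eq_mod]; norm_num; ring

/-- The words `gens` fix the vectors `v` and `a`, and move every vector with norm `c` and with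
scalar products `d` and `e` with `v` and `a` to one of `reps`. -/
noncomputable def orbitCheck (v a c d e : ℕ) (gens : List (List ℕ)) (reps : List ℕ) (fuel : ℕ) :
    Bool :=
  (gens.all fun w => w.all isRoot && Nat.beq (actCode w v) v && Nat.beq (actCode w a) a) &&
    force (search gens fuel [] 0 reps (bitMask reps)) fun vis =>
      sweep (fun n s x y => !(Nat.beq (Nat.mod s 3) c) || !(Nat.beq (Nat.mod x 3) d) ||
        !(Nat.beq (Nat.mod y 3) e) || vis.testBit n) (digitPairs v a) 0 0 0 0

/-- The sweep forces the code of u into the mask, and everything in the mask can be carried back to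
a representative by a word fixing v and a. -/
theorem exists_word_of_orbitCheck {v a c d e : ℕ} {gens : List (List ℕ)} {reps : List ℕ}
    {fuel : ℕ} (h : orbitCheck v a c d e gens reps fuel = true) (hc : c < 3) (hd : d < 3)
    (he : e < 3) {u : Fin 8 → ZMod 3} (huu : u ⬝ᵥ u = c) (huv : u ⬝ᵥ vec v = d)
    (hua : u ⬝ᵥ vec a = e) :
    ∃ w, IsWord w ∧ act w (vec v) = vec v ∧ act w (vec a) = vec a ∧
      ∃ r ∈ reps, act w u = vec r := by
  rw [orbitCheck, Bool.and_eq_true, force_eq] at h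
  obtain ⟨hg, h⟩ := h
  have hg' : ∀ w ∈ gens, IsWord w ∧ act w (vec v) = vec v ∧ act w (vec a) = vec a := by
    intro w hw
    have := List.all_eq_true.1 hg w hw
    rw [Bool.and_eq_true, Bool.and_eq_true, List.all_eq_true] at this
    refine ⟨this.1.1, ?_, ?_⟩
    · rw [← vec_actCode, Nat.eq_of_beq_eq_true this.1.2]
    · rw [← vec_actCode, Nat.eq_of_beq_eq_true this.2]
  have inv : ∀ g ∈ gens, ∀ b, act g b = b → act g.reverse b = b := fun g hgm b hb => by
    conv_lhs => rw [← hb]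
    exact (hg' g hgm).1.act_reverse b
  have key := search_sound (gens := gens)
    (P := fun n => ∃ w, IsWord w ∧ act w (vec v) = vec v ∧ act w (vec a) = vec a ∧
      ∃ r ∈ reps, act w (vec n) = vec r) (by
      rintro g hgm x ⟨w, hw, hwv, hwa, r, hr, e⟩
      obtain ⟨h1, h2, h3⟩ := hg' g hgm
      -- From the image of x under g, first undo g, then use the word for x.
      refine ⟨g.reverse ++ w, h1.reverse.append hw, ?_, ?_, r, hr, ?_⟩
      · rw [act_append, inv g hgm _ h2, hwv]
      · rw [act_append, inv g hgm _ h3, hwa]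
      · rw [act_append, vec_actCode, h1.act_reverse, e]) fuel [] 0 reps (bitMask reps)
    (List.nil_subset _) (by simp)
    (fun y hy => ⟨[], by simp [IsWord], rfl, rfl, y, hy, rfl⟩)
    (fun n hn => ⟨[], by simp [IsWord], rfl, rfl, n, mem_of_testBit_bitMask hn, rfl⟩)
  obtain ⟨s, x, y, hgood, hs, hx, hy⟩ := sweep_digitPairs h u
  have mod_eq : ∀ {s c : ℕ}, c < 3 → (s : ZMod 3) = c → Nat.beq (Nat.mod s 3) c = true := by
    intro s c hc h
    rw [ZMod.natCast_eq_natCast_iff', Nat.mod_eq_of_lt hc] at h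
    rw [Nat.beq_eq]
    exact h
  rw [mod_eq hc (hs.trans huu), mod_eq hd (hx.trans huv), mod_eq he (hy.trans hua)] at hgood
  have := key (code u) (by simpa using hgood)
  rwa [vec_code] at this

/-! ### The data of the classification -/

/-- Further entries, with gauge group `SU(2)^2 × U(1)^6`. -/
def extraEntries : Table → List Entry
  | .t1 => [
      ⟨![-1, 1, 0, 1, 1, 0, 0, 0], ![0, -1, -2, 1, 0, 1, 1, 0], .case5⟩,
      ⟨![0, 1, 1, 1, 1, 0, 0, 0], ![0, -1, -2, 1, -1, 1, 0, 0], .case5⟩]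
  | .t2 => [
      ⟨![-1, 0, 0, 1, 1, 1, 1, -1], ![-1, 0, -1, 0, 0, -1, -1, 2], .case5⟩,
      ⟨![-1, 1, -1, 1, 1, 1, 0, 0], ![0, -1, -2, 1, 1, 0, 1, 0], .case5⟩]
  | .t4 => [
      ⟨![-2, 0, 0, 1, 1, 0, 0, 0], ![0, -1, -2, 1, 0, 1, 1, 0], .case5⟩,
      ⟨![-1, 1, 0, 1, 1, 1, 1, 0], ![0, -1, -2, 1, 1, 0, 0, 1], .case5⟩]
  | .t6 => [
      ⟨![-2, 0, -1, 1, 1, 1, 0, 0], ![1, 1, 1, 1, 0, -1, 1, 0], .case5⟩,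
      ⟨![-2, 1, 1, 1, 1, 0, 0, 0], ![1, 0, -1, 1, -1, 1, 1, 0], .case5⟩]
  | .t8b => [
      ⟨![-1, 0, 0, 0, -1, 1, 1, 0], ![1, 1, 1, 0, -1, 0, -1, 1], .case5⟩,
      ⟨![0, 1, 1, 1, 0, 1, 0, 0], ![1, 1, 1, -1, 0, 1, 1, 0], .case5⟩,
      ⟨![-1, 1, 1, 0, 0, 1, 0, 0], ![1, 1, 1, 0, -1, 1, 1, 0], .case5⟩]
  | .t9b => [
      ⟨![-2, 0, 0, 0, -1, 1, 1, -1], ![0, 0, 0, -1, -2, 1, -1, 1], .case5⟩,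
      ⟨![-2, 0, 0, 0, -1, 1, 1, -1], ![0, 0, 0, -1, -2, -1, 1, 1], .case5⟩,
      ⟨![-2, 0, 0, 0, -1, 1, 1, -1], ![0, 0, -1, -2, 0, 1, 1, 1], .case5⟩,
      ⟨![-2, 0, 0, 0, -1, 1, 1, -1], ![0, 0, -1, -2, 0, 1, -1, -1], .case5⟩,
      ⟨![-2, 0, 0, 0, -1, 1, 1, -1], ![0, 0, -1, -1, -1, 0, -1, 2], .case5⟩,
      ⟨![-2, 0, 0, 0, -1, 1, 1, -1], ![0, 0, -1, -1, -1, 0, -2, 1], .case5⟩]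
  | _ => []

/-- All entries of the extended table. -/
def allEntries (t : Table) : List Entry := t.entries ++ extraEntries t

/-- Generators of the stabilizer of the twist of a table: the reflections in a system of simple
roots. -/
def twistStabilizer : Table → List (List ℕ)
  | .t1 | .t2 | .t4 | .t6 =>
    [[20], [15], [135], [405], [1215], [5832], [3645], [4372]]
  | .t8a | .t9a =>
    [[45], [135], [405], [1215], [5832], [3645], [4372]]
  | .t8b | .t9b =>
    [[15], [45], [135], [1215], [5832], [3645], [4252], [6478]]

/-- Classes of first Wilson lines, representing all orbits under the stabilizer of the twist, with
generators of the stabilizers of the pair of twist and Wilson line. -/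
def wilsonLines : Table → List (ℕ × List (List ℕ))
  | .t1 =>
    [(2, [[15], [135], [405], [1215], [5832], [3645]]),
     (223, [[8], [135], [1215], [5832], [3645], [4264]])]
  | .t2 =>
    [(4348, [[15], [135], [405], [1215], [5832], [4372]]),
     (65, [[20], [405], [1215], [5832], [3645], [6532]])]
  | .t4 =>
    [(218, [[15], [135], [1215], [5832], [3645], [4264]]),
     (17, [[20], [135], [405], [1215], [5832], [3645]])]
  | .t6 =>
    [(55, [[15], [405], [1215], [5832], [3645], [6532]]),
     (713, [[20], [135], [405], [5832], [3645], [4048]])]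
  | .t8a =>
    [(720, [[45], [135], [405], [5832], [3645], [4048]])]
  | .t8b =>
    [(2026, [[15], [45], [1215], [3280], [3616], [5506]])]
  | .t9a =>
    [(20, [[135], [405], [1215], [5832], [3645], [4372]]),
     (4369, [[45], [135], [405], [1215], [5832], [5470], [4372]]),
     (4, [])]
  | .t9b =>
    [(487, [[15], [45], [135], [5832], [3645], [6196], [4048]]),
     (6401, [[15], [45], [1215], [3645], [3280], [3616], [6478]]),
     (4214, [[15], [45], [1215], [5832], [4252], [5506], [87, 1944, 6196, 5560, 4126, 20]]),
     (122, [])]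

/-- Classes of simple roots of the unbroken group of each entry of the extended tables. -/
def simpleRoots : Table → List (List ℕ)
  | .t1 => [
      [135, 405, 1215, 3645, 5832], [135, 405, 1215, 3645, 5832], [135, 405, 1215, 3645, 5832],
      [2241, 5832, 1215, 405, 15], [4428, 3645, 1215, 405, 15], [4264, 3645, 1215, 5832, 135],
      [4264, 3645, 1215, 5832, 8], [4264, 3645, 1215, 5832, 135], [4264, 3645, 1215, 5832, 15],
      [4264, 3645, 1215, 5832, 135], [2241, 5832, 1215, 405, 20], [4428, 3645, 1215, 405, 20],
      [3645, 1215, 5832, 15, 135], [3645, 1215, 5832, 8, 135], [3645, 1215, 5832, 8, 135],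
      [3645, 1215, 5832, 15, 135], [3645, 1215, 5832, 15, 135], [3645, 1215, 5832, 20, 135],
      [405, 135, 5832, 3645], [5832, 6208, 8, 3645], [3645, 4264, 135, 5832],
      [5832, 1215, 135, 4264], [3645, 1215, 135, 3292], [3645, 4264, 8, 5832],
      [3645, 1215, 135, 3292], [5832, 1215, 8, 135], [5832, 6208, 15, 3645],
      [5832, 6208, 135, 3645], [3645, 4264, 135, 5832], [3645, 4264, 15, 5832],
      [5832, 1215, 15, 135], [405, 135, 5832, 3645], [405, 135, 5832, 3645], [1215, 3292],
      [5832, 3645]]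
  | .t2 => [
      [6532, 5832, 1215, 405, 3645], [6532, 5832, 1215, 405, 3645], [135, 405, 1215, 3645, 5832],
      [6532, 5832, 1215, 3645, 20], [4264, 3645, 1215, 5832, 20], [2241, 5832, 1215, 405, 15],
      [4428, 3645, 1215, 405, 15], [5832, 1215, 405, 135, 15], [5832, 1215, 405, 135, 4372],
      [3645, 4048, 135, 405, 5832], [3645, 4048, 135, 405, 8], [3645, 4048, 135, 405, 5832],
      [3645, 1215, 405, 20, 3292], [3645, 1215, 5832, 15, 135], [5832, 1215, 297, 15, 4372],
      [5832, 891, 135, 15, 4372], [405, 4102, 3645, 8, 5832], [135, 4048, 3645, 8, 5832],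
      [1215, 405, 3292, 6532], [5832, 6532, 405, 3645], [405, 135, 5832, 3645],
      [4536, 135, 15, 1215], [1215, 405, 15, 4428], [1215, 405, 4428, 4372],
      [4536, 135, 1215, 4372], [405, 135, 15, 4372], [405, 4102, 8, 5506],
      [135, 4048, 5832, 5722], [3645, 4048, 405, 5832], [405, 135, 5832, 3645],
      [405, 135, 5832, 3645], [135, 5506, 8, 4264], [405, 5560, 8, 5832], [135, 1215], [135, 5722]]
  | .t4 => [
      [135, 405, 1215, 3645, 5832], [135, 405, 1215, 3645, 5832], [135, 405, 1215, 3645, 5832],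
      [4264, 3645, 1215, 5832, 15], [4264, 3645, 1215, 5832, 135], [5832, 1215, 405, 135, 20],
      [3645, 1215, 405, 135, 20], [5506, 135, 405, 1215, 4372], [5506, 135, 405, 1215, 8],
      [5506, 135, 405, 1215, 4372], [5832, 1215, 405, 135, 15], [3645, 1215, 405, 135, 15],
      [3645, 1215, 5832, 15, 135], [5722, 1215, 5832, 15, 135], [3645, 1215, 5832, 20, 135],
      [5506, 135, 405, 8, 4372], [1215, 405, 135, 8, 4372], [3645, 1215, 5832, 15, 135],
      [1215, 5722, 15, 135], [5832, 1215, 135, 4264], [3645, 1215, 135, 3292],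
      [5832, 6208, 15, 3645], [3645, 4264, 15, 5832], [405, 135, 5832, 3645],
      [405, 135, 5832, 3645], [405, 5560, 8, 4372], [1215, 5722, 135, 4372],
      [135, 5506, 1215, 4372], [405, 135, 8, 6208], [135, 5506, 1215, 4372],
      [1215, 405, 5506, 4372], [405, 135, 8, 6208], [405, 135, 5832, 3645], [1215, 3292],
      [135, 1215]]
  | .t6 => [
      [6532, 5832, 1215, 405, 3645], [6532, 5832, 1215, 405, 3645], [6532, 5832, 1215, 405, 3645],
      [5560, 405, 1215, 5832, 15], [6532, 5832, 1215, 3645, 15], [4264, 3645, 1215, 5832, 20],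
      [6532, 5832, 1215, 3645, 20], [3645, 4048, 135, 405, 5832], [3645, 4048, 135, 405, 20],
      [3645, 4048, 135, 405, 5832], [4372, 3645, 1215, 5832, 15], [4372, 3645, 1215, 5832, 135],
      [3645, 1215, 405, 15, 6532], [405, 4102, 3645, 20, 5832], [405, 4102, 3645, 20, 5832],
      [405, 4102, 3645, 20, 5832], [3645, 1215, 5832, 15, 135], [3645, 1215, 5832, 15, 135],
      [5832, 6208, 405, 3645], [5832, 6532, 405, 3645], [5832, 6208, 405, 3645],
      [3645, 4264, 135, 5832], [405, 135, 5832, 3645], [135, 5506, 20, 5832],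
      [3645, 4264, 20, 135], [135, 5506, 20, 4264], [3645, 4048, 405, 5832],
      [405, 135, 5832, 3645], [5832, 6316, 135, 3645], [5832, 1215, 15, 135],
      [3645, 4372, 15, 5832], [3645, 4372, 135, 5832], [3645, 1215, 15, 3400], [4264, 5560],
      [1215, 4372]]
  | .t8a => [
      [3645, 4048, 135, 45, 405], [3645, 4048, 135, 45, 5832], [5506, 135, 405, 4120, 5832],
      [405, 135, 45, 5, 5832], [405, 135, 5, 3645]]
  | .t8b => [
      [1215, 3616, 45, 15, 3280], [1215, 3616, 45, 15, 5506], [3645, 4102, 45, 15, 5832],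
      [15, 3634, 1215, 3280, 5506], [45, 3616, 1215, 3280, 5506], [15, 4120, 3645, 135, 5832],
      [15, 4120, 3645, 135, 5832], [1215, 3640, 45, 5506], [45, 15, 3280, 5506],
      [1215, 3640, 45, 3280], [45, 4102, 3640, 5506], [15, 4120, 3280, 3616],
      [3645, 4252, 135, 5832], [15, 4120, 135, 4252], [15, 5578, 5832, 5710],
      [45, 15, 5832, 3645], [3645, 4120, 33, 5832], [15, 3616], [15, 5560], [15, 4252]]
  | .t9a => [
      [3645, 1215, 405, 3400, 135], [3645, 4048, 135, 405, 5832], [5832, 1215, 405, 99, 5],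
      [4536, 135, 45, 5, 1215], [405, 135, 4392, 4372]]
  | .t9b => [
      [3645, 4102, 45, 15, 5832], [3645, 4048, 135, 45, 6556], [1215, 3616, 45, 15, 6478],
      [4048, 135, 45, 5832, 5584], [15, 3634, 1215, 164, 5560], [15, 5578, 135, 6196],
      [45, 5560, 164, 3640], [5506, 4252, 15, 4860], [5832, 1215, 45, 5506],
      [5832, 1215, 45, 5506], [45, 15, 4860, 4252], [5832, 1215, 15, 164], [45, 15, 4860, 4252],
      [45, 15, 4860, 5506], [45, 15, 4860, 5506], [45, 5560, 4126, 6478], [15, 5832], [15, 4860],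
      [164, 1215], [164, 4860], [45, 4252], [45, 4252]]

/-- The rows of the Cartan matrix. -/
def cartanRows : GaugeCase → List (List ℤ)
  | .case1 => [[2, -1, 0, 0, 0], [-1, 2, -1, 0, 0], [0, -1, 2, -1, -1], [0, 0, -1, 2, 0],
      [0, 0, -1, 0, 2]]
  | .case2 => [[2, -1, 0, 0, 0], [-1, 2, -1, 0, 0], [0, -1, 2, -1, 0], [0, 0, -1, 2, 0],
      [0, 0, 0, 0, 2]]
  | .case3 => [[2, -1, 0, 0, 0], [-1, 2, -1, 0, 0], [0, -1, 2, 0, 0], [0, 0, 0, 2, 0],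
      [0, 0, 0, 0, 2]]
  | .case4 => [[2, -1, 0, 0], [-1, 2, 0, 0], [0, 0, 2, 0], [0, 0, 0, 2]]
  | .case5 => [[2, 0], [0, 2]]

/-- The positive roots, as combinations of simple roots. -/
def positiveRoots : GaugeCase → List (List ℕ)
  | .case1 => [
      [1, 0, 0, 0, 0], [0, 1, 0, 0, 0], [0, 0, 1, 0, 0], [0, 0, 0, 1, 0], [0, 0, 0, 0, 1],
      [1, 1, 0, 0, 0], [0, 1, 1, 0, 0], [0, 0, 1, 1, 0], [0, 0, 1, 0, 1], [1, 1, 1, 0, 0],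
      [0, 1, 1, 1, 0], [0, 1, 1, 0, 1], [0, 0, 1, 1, 1], [1, 1, 1, 1, 0], [1, 1, 1, 0, 1],
      [0, 1, 1, 1, 1], [1, 1, 1, 1, 1], [0, 1, 2, 1, 1], [1, 1, 2, 1, 1], [1, 2, 2, 1, 1]]
  | .case2 => [
      [1, 0, 0, 0, 0], [0, 1, 0, 0, 0], [0, 0, 1, 0, 0], [0, 0, 0, 1, 0], [0, 0, 0, 0, 1],
      [1, 1, 0, 0, 0], [0, 1, 1, 0, 0], [0, 0, 1, 1, 0], [1, 1, 1, 0, 0], [0, 1, 1, 1, 0],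
      [1, 1, 1, 1, 0]]
  | .case3 => [
      [1, 0, 0, 0, 0], [0, 1, 0, 0, 0], [0, 0, 1, 0, 0], [0, 0, 0, 1, 0], [0, 0, 0, 0, 1],
      [1, 1, 0, 0, 0], [0, 1, 1, 0, 0], [1, 1, 1, 0, 0]]
  | .case4 => [
      [1, 0, 0, 0], [0, 1, 0, 0], [0, 0, 1, 0], [0, 0, 0, 1], [1, 1, 0, 0]]
  | .case5 => [
      [1, 0], [0, 1]]

/-! ### Orbits of twists and Wilson lines -/

/-- The code of the class of an integral vector. -/
def classCode (x : Fin 8 → ℤ) : ℕ :=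
  (2 * x 0 % 3).toNat + 3 * (2 * x 1 % 3).toNat + 9 * (2 * x 2 % 3).toNat +
    27 * (2 * x 3 % 3).toNat + 81 * (2 * x 4 % 3).toNat + 243 * (2 * x 5 % 3).toNat +
    729 * (2 * x 6 % 3).toNat + 2187 * (2 * x 7 % 3).toNat

theorem vec_classCode (x : Fin 8 → ℤ) : vec (classCode x) = red (2 • x) := by
  rw [classCode, ternary_digits (fun i => (2 * x i % 3).toNat) fun i => by omega]
  ext i
  have h : (((2 * x i % 3).toNat : ℤ) : ZMod 3) = ((2 * x i % 3 : ℤ) : ZMod 3) := by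
    rw [Int.toNat_of_nonneg (Int.emod_nonneg _ (by norm_num))]
  rw [Int.cast_natCast] at h
  rw [h, (ZMod.intCast_eq_intCast_iff' (2 * x i % 3) (2 * x i) 3).2
    (Int.emod_emod_of_dvd _ dvd_rfl)]
  simp [red]

/-- The sum of the products of the coordinates. -/
def intDot (x y : Fin 8 → ℤ) : ℤ :=
  x 0 * y 0 + x 1 * y 1 + x 2 * y 2 + x 3 * y 3 + x 4 * y 4 + x 5 * y 5 + x 6 * y 6 + x 7 * y 7

theorem intDot_eq (x y : Fin 8 → ℤ) : intDot x y = x ⬝ᵥ y := by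
  simp [intDot, dotProduct, Fin.sum_univ_eight]

/-- The scalar products modulo three required of the classes of a completion. -/
def CMM.gram (m : CMM) (p q : Fin 3) : ℕ := (-intDot (m.triple p) (m.triple q) % 3).toNat

/-- The code of the twist of a table. -/
def Table.twistCode (t : Table) : ℕ := classCode t.twist

/-- The tables of a CMM embedding. -/
def CMM.tables : CMM → List Table
  | .cmm1 => [.t1]
  | .cmm2 => [.t2]
  | .cmm4 => [.t4]
  | .cmm6 => [.t6]
  | .cmm8 => [.t8a, .t8b]
  | .cmm9 => [.t9a, .t9b]

theorem CMM.cmm_of_mem_tables {m : CMM} {t : Table} (h : t ∈ m.tables) : t.cmm = m := by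
  cases m <;> simp only [CMM.tables, List.mem_cons, List.not_mem_nil, or_false] at h <;>
    rcases h with rfl | rfl <;> rfl

/-- A system of simple roots of `E8`. -/
def simpleReflections : List (List ℕ) :=
  [[15], [45], [135], [405], [1215], [5832], [3645], [4372]]

/-- With both fixed vectors zero only the norm condition is effective. The zero class also has norm
zero and must be listed; it is excluded later by the product with the first Wilson line. -/
theorem orbitCheck_norm_zero :
    orbitCheck 0 0 0 0 0 simpleReflections [Table.t1.twistCode, 0] 25000 = true := by
  decide +kernel

theorem orbitCheck_norm_two :
    orbitCheck 0 0 2 0 0 simpleReflections [Table.t8a.twistCode, Table.t8b.twistCode] 25000 =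
      true := by
  decide +kernel

/-- At this stage only the twist has to be fixed, so it fills both slots for fixed vectors and its
condition is repeated. -/
theorem orbitCheck_wilsonLine (t : Table) :
    (force t.twistCode fun v => force (t.cmm.gram 0 1) fun d => force (t.cmm.gram 1 1) fun c =>
      orbitCheck v v c d d (twistStabilizer t) ((wilsonLines t).map Prod.fst) 10000) = true := by
  cases t <;> decide +kernel

/-- The classes of the second Wilson lines of the entries with a given first Wilson line. -/
def secondLines (t : Table) (a : ℕ) : List ℕ :=
  ((allEntries t).filter fun r => classCode r.a1 == a).map fun r => classCode r.a3

/-- For CMM 9 two listed first lines, `4` and `122`, are the negatives of the twist class and have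
no entries. There the search is empty and the sweep verifies that no second line exists: its
required products with twist and first line, 0 and 1, would have to be opposite. -/
theorem orbitCheck_secondLine (t : Table) :
    (force t.twistCode fun v => force (t.cmm.gram 0 2) fun d => force (t.cmm.gram 1 2) fun e =>
      force (t.cmm.gram 2 2) fun c => (wilsonLines t).all fun a =>
        orbitCheck v a.1 c d e a.2 (secondLines t a.1) 3000) = true := by
  cases t <;> decide +kernel

/-! ### Invariance of the gauge group -/

/-- The Weyl reflection as a linear map. -/
noncomputable def weylLinear (e : Fin 8 → ℝ) : (Fin 8 → ℝ) →ₗ[ℝ] (Fin 8 → ℝ) where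
  toFun := weylReflection e
  map_add' x y := by simp only [weylReflection, add_dotProduct, add_smul]; abel
  map_smul' c x := by
    simp only [weylReflection, smul_dotProduct, smul_eq_mul, mul_smul, RingHom.id_apply, smul_sub]

theorem weylReflection_dotProduct {e : Fin 8 → ℝ} (he : e ⬝ᵥ e = 2) (x y : Fin 8 → ℝ) :
    weylReflection e x ⬝ᵥ weylReflection e y = x ⬝ᵥ y := by
  simp only [weylReflection, sub_dotProduct, dotProduct_sub, smul_dotProduct, dotProduct_smul, he,
    smul_eq_mul, dotProduct_comm e y]
  ring

theorem weylReflection_weylReflection {e : Fin 8 → ℝ} (he : e ⬝ᵥ e = 2) (x : Fin 8 → ℝ) :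
    weylReflection e (weylReflection e x) = x := by
  ext i
  simp only [weylReflection, sub_dotProduct, smul_dotProduct, he, smul_eq_mul, Pi.sub_apply,
    Pi.smul_apply]
  ring

theorem weylReflection_mem_e8Roots {e x : Fin 8 → ℝ} (he : e ∈ e8Roots) (hx : x ∈ e8Roots) :
    weylReflection e x ∈ e8Roots := by
  refine ⟨?_, by rw [weylReflection_dotProduct he.2, hx.2]⟩
  obtain ⟨r, hr, rfl⟩ := mem_e8Lattice_iff.1 he.1
  obtain ⟨y, hy, rfl⟩ := mem_e8Lattice_iff.1 hx.1
  obtain ⟨k, hk⟩ := hy.four_dvd_dotProduct hr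
  refine mem_e8Lattice_iff.2 ⟨y - k • r, hy.sub (hr.zsmul k), ?_⟩
  ext i
  simp only [weylReflection, half_dotProduct, hk, Pi.sub_apply, Pi.smul_apply, smul_eq_mul, half]
  push_cast; ring

/-- Lattice vectors have integral products with roots. -/
theorem unbrokenRoots_translate (E : Embedding (Fin 8)) (p : Fin 3) {l : Fin 8 → ℝ}
    (hl : l ∈ e8Lattice) : unbrokenRoots (Function.update E p (E p + l)) = unbrokenRoots E := by
  ext e
  refine and_congr_right fun he => forall_congr' fun q => ?_
  obtain ⟨k, hk⟩ := exists_int_dotProduct hl he.1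
  rcases eq_or_ne q p with rfl | h
  · rw [Function.update_self, add_dotProduct, hk]
    constructor
    · rintro ⟨n, hn⟩; exact ⟨n - k, by push_cast; linarith⟩
    · rintro ⟨n, hn⟩; exact ⟨n + k, by push_cast; linarith⟩
  · rw [Function.update_of_ne h]

theorem mem_unbrokenRoots_reflect {E : Embedding (Fin 8)} {e x : Fin 8 → ℝ} (he : e ∈ e8Roots)
    (hx : x ∈ unbrokenRoots fun p => weylReflection e (E p)) :
    weylReflection e x ∈ unbrokenRoots E := by
  refine ⟨weylReflection_mem_e8Roots he hx.1, fun p => ?_⟩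
  obtain ⟨k, hk⟩ := hx.2 p
  refine ⟨k, ?_⟩
  rw [← hk, ← weylReflection_dotProduct he.2 (E p), weylReflection_weylReflection he.2]

/-- A reflection is an isometric involution permuting the roots, so it carries a simple system for F
to one for E with the same Cartan matrix. -/
theorem HasGaugeGroup.of_operation {ι : Type} [Fintype ι] {E F : Embedding (Fin 8)}
    (h : Operation E F) {C : Matrix ι ι ℤ} {u : ℕ} (hF : HasGaugeGroup F C u) :
    HasGaugeGroup E C u := by
  obtain ⟨hu, α, ⟨hli, hmem, hspan⟩, hC⟩ := hF
  cases h with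
  | translate p l hl =>
    rw [unbrokenRoots_translate E p hl] at hmem hspan
    exact ⟨hu, α, ⟨hli, hmem, hspan⟩, hC⟩
  | reflect e he =>
    refine ⟨hu, fun i => weylReflection e (α i), ⟨?_, fun i => ?_, fun x hx => ?_⟩, fun i j => ?_⟩
    · refine hli.map' (weylLinear e) (LinearMap.ker_eq_bot.2 fun x y hxy => ?_)
      have : weylReflection e x = weylReflection e y := hxy
      rw [← weylReflection_weylReflection he.2 x, this, weylReflection_weylReflection he.2]
    · exact mem_unbrokenRoots_reflect he (hmem i)
    · have hx' : weylReflection e x ∈ unbrokenRoots fun p => weylReflection e (E p) := by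
        refine mem_unbrokenRoots_reflect he ?_
        simpa only [weylReflection_weylReflection he.2] using hx
      obtain ⟨c, hc⟩ := hspan _ hx'
      have hl : ∑ i, c i • weylReflection e (α i) = weylLinear e (∑ i, c i • α i) := by
        simp only [map_sum, map_nsmul]; rfl
      refine ⟨c, ?_⟩
      rw [hl, ← map_neg]
      refine hc.imp (fun h => ?_) fun h => ?_ <;> rw [← h] <;>
        exact (weylReflection_weylReflection he.2 x).symm
    · rw [weylReflection_dotProduct he.2, hC]

theorem HasCase.of_equivalent {E F : Embedding (Fin 8)} (h : Equivalent E F) {g : GaugeCase}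
    (hF : HasCase F g) : HasCase E g := by
  induction h using Relation.ReflTransGen.head_induction_on with
  | refl => exact hF
  | head h _ ih => cases g <;> exact HasGaugeGroup.of_operation h ih

/-! ### Enumeration of the roots -/

theorem code_digit (v : Fin 8 → ZMod 3) (i : Fin 8) : code v / 3 ^ (i : ℕ) % 3 = (v i).val := by
  have := congrArg ZMod.val (congrFun (vec_code v) i)
  rwa [vec, ZMod.val_natCast] at this

/-- The number of nonzero ternary digits. -/
def weight (n : ℕ) : ℕ :=
  let d (p : ℕ) := Nat.div (Nat.add (Nat.mod (Nat.div n p) 3) 1) 2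
  Nat.add (Nat.add (Nat.add (d 1) (d 3)) (Nat.add (d 9) (d 27)))
    (Nat.add (Nat.add (d 81) (d 243)) (Nat.add (d 729) (d 2187)))

theorem weight_code (v : Fin 8 → ZMod 3) : weight (code v) = ∑ i, ((v i).val + 1) / 2 := by
  simp only [← code_digit, Fin.sum_univ_eight]
  change (code v / 1 % 3 + 1) / 2 + (code v / 3 % 3 + 1) / 2 +
    ((code v / 9 % 3 + 1) / 2 + (code v / 27 % 3 + 1) / 2) +
    ((code v / 81 % 3 + 1) / 2 + (code v / 243 % 3 + 1) / 2 +
    ((code v / 729 % 3 + 1) / 2 + (code v / 2187 % 3 + 1) / 2)) = _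
  simp only [Fin.coe_ofNat_eq_mod]
  norm_num
  ring

theorem rootOf_code (v : Fin 8 → ZMod 3) (i : Fin 8) :
    rootOf (code v) i = if ∃ j, v j = 0 then -2 * centered (v i).val else centered (v i).val := by
  have h : (∏ j, (v j).val = 0) = ∃ j, v j = 0 := by
    simp [Finset.prod_eq_zero_iff, ZMod.val_eq_zero]
  have h' : ∏ j, (v j).val = code v % 3 * (code v / 3 % 3) * (code v / 9 % 3) *
      (code v / 27 % 3) * (code v / 81 % 3) * (code v / 243 % 3) * (code v / 729 % 3) *
      (code v / 2187 % 3) := by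
    simp only [← code_digit, Fin.prod_univ_eight, Fin.coe_ofNat_eq_mod]
    norm_num
  simp only [rootOf, code_digit, ← h', h]

/-- A root is determined by its class. Norm 8 bounds the doubled coordinates by 2, leaving two
shapes: two entries ±2 and six zeros, or eight entries ±1. A zero digit tells them apart, and the
signs are read off modulo three. -/
theorem IsDoubledRoot.rootOf_code {y : Fin 8 → ℤ} (hy : IsDoubledRoot y) :
    rootOf (code (red y)) = y ∧ (weight (code (red y)) = 2 ∨ weight (code (red y)) = 8) := by
  obtain ⟨⟨-, hp⟩, h8⟩ := hy
  have hsq : ∀ i, y i * y i ≤ 8 := fun i => by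
    rw [← h8]
    exact Finset.single_le_sum (f := fun j => y j * y j) (fun j _ => mul_self_nonneg _)
      (Finset.mem_univ i)
  have hle : ∀ i, y i ≤ 2 := fun i => by nlinarith [hsq i]
  have hge : ∀ i, -2 ≤ y i := fun i => by nlinarith [hsq i]
  rw [weight_code]
  simp only [funext_iff, HiddenSector.rootOf_code]
  rcases Int.even_or_odd (y 0) with h0 | h0
  · have hy : ∀ i, y i = -2 ∨ y i = 0 ∨ y i = 2 := fun i => by
      have := hp i; have := hle i; have := hge i
      rw [even_iff_two_dvd] at h0
      omega
    have hval : ∀ i, (((red y i).val + 1) / 2 : ℕ) * 4 = y i * y i ∧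
        -2 * centered (red y i).val = y i := fun i => by
      simp only [red]
      rcases hy i with h | h | h <;> rw [h] <;> decide
    -- Without a zero coordinate the norm would be 8 · 4 = 32.
    have hz : ∃ j, red y j = 0 := by
      by_contra! hne
      have : ∀ j, y j * y j = 4 := fun j => by
        rcases hy j with h | h | h
        · rw [h]; rfl
        · exact absurd (by simp [red, h]) (hne j)
        · rw [h]; rfl
      simp [dotProduct, this] at h8
    refine ⟨fun i => ?_, Or.inl ?_⟩
    · rw [if_pos hz, (hval i).2]
    · have : ((∑ i, ((red y i).val + 1) / 2 : ℕ) : ℤ) * 4 = 8 := by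
        rw [Nat.cast_sum, Finset.sum_mul, ← h8]
        exact Finset.sum_congr rfl fun i _ => (hval i).1
      omega
  · have hy : ∀ i, y i = -1 ∨ y i = 1 := fun i => by
      have := hp i; have := hle i; have := hge i
      rw [Int.odd_iff] at h0
      omega
    have hval : ∀ i, ((red y i).val + 1) / 2 = 1 ∧ centered (red y i).val = y i ∧
        red y i ≠ 0 := fun i => by
      simp only [red]
      rcases hy i with h | h <;> rw [h] <;> decide
    refine ⟨fun i => ?_, Or.inr ?_⟩
    · rw [if_neg (by rintro ⟨j, hj⟩; exact (hval j).2.2 hj), (hval i).2.1]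
    · simp [fun i => (hval i).1]

/-! ### Gauge groups from simple roots -/

/-- The combination of coded roots with the given coefficients. -/
def combination : List ℕ → List ℕ → Fin 8 → ℤ
  | c :: cs, r :: rs, i => c * rootOf r i + combination cs rs i
  | _, _, _ => 0

/-- The default coefficient 0 matches `combination` when c is too short; surplus coefficients are
ignored on both sides. -/
theorem combination_eq_sum (c s : List ℕ) (i : Fin 8) :
    combination c s i = ∑ j : Fin s.length, (c.getD j 0 : ℤ) * rootOf (s.getD j 0) i := by
  induction s generalizing c with
  | nil => cases c <;> simp [combination]
  | cons r s ih =>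
    cases c with
    | nil => simp [combination]
    | cons a c =>
      rw [combination, ih]
      simp only [List.length_cons, Fin.sum_univ_succ]
      simp

/-- The Gram matrix of the proposed simple roots is the Cartan matrix, so its nonzero determinant
gives linear independence. The factor 4 comes from doubled coordinates. -/
theorem hasGaugeGroup_of_simpleRoots {ι : Type} [Fintype ι] [DecidableEq ι]
    {E : Embedding (Fin 8)} {C : Matrix ι ι ℤ} {u : ℕ} {s : List ℕ} (σ : ι ≃ Fin s.length)
    (hu : s.length + u = 8) (hdet : C.det ≠ 0)
    (hC : ∀ i j, rootOf (s.getD (σ i) 0) ⬝ᵥ rootOf (s.getD (σ j) 0) = 4 * C i j)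
    (hmem : ∀ r ∈ s, half (rootOf r) ∈ unbrokenRoots E)
    (hspan : ∀ e ∈ unbrokenRoots E, ∃ c : List ℕ,
      e = half (combination c s) ∨ e = -half (combination c s)) : HasGaugeGroup E C u := by
  set α : ι → Fin 8 → ℝ := fun i => half (rootOf (s.getD (σ i) 0)) with hα
  have hdot : ∀ i j, α i ⬝ᵥ α j = (C i j : ℝ) := fun i j => by
    rw [hα, half_dotProduct, hC]; push_cast; ring
  refine ⟨by rw [Fintype.card_congr σ, Fintype.card_fin, hu], α, ⟨?_, fun i => ?_, ?_⟩, hdot⟩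
  · rw [Fintype.linearIndependent_iff]
    intro g hg
    -- Pair the linear relation with each simple root.
    have h0 : g ᵥ* (C.map (Int.castRingHom ℝ)) = 0 := by
      ext j
      have := congrArg (fun v => v ⬝ᵥ α j) hg
      simp only [sum_dotProduct, smul_dotProduct, hdot, zero_dotProduct, smul_eq_mul] at this
      simpa [Matrix.vecMul, dotProduct] using this
    have hd : (C.map (Int.castRingHom ℝ)).det ≠ 0 := by
      have := (Int.castRingHom ℝ).map_det C
      rw [RingHom.mapMatrix_apply] at this
      rw [← this]
      simpa using hdet
    exact fun i => congrFun (Matrix.eq_zero_of_vecMul_eq_zero hd h0) i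
  · refine hmem _ ?_
    rw [List.getD_eq_getElem _ _ (σ i).2]
    exact List.getElem_mem _
  · intro e he
    obtain ⟨c, hc⟩ := hspan e he
    refine ⟨fun i => c.getD (σ i) 0, ?_⟩
    have : half (combination c s) = ∑ i, c.getD (σ i) 0 • α i := by
      ext k
      rw [half, combination_eq_sum, Finset.sum_apply,
        ← σ.sum_comp fun j : Fin s.length => (c.getD j 0 : ℤ) * rootOf (s.getD j 0) k]
      push_cast
      rw [Finset.sum_div]
      refine Finset.sum_congr rfl fun i _ => ?_
      simp only [hα, Pi.smul_apply, nsmul_eq_mul, half]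
      ring
    rwa [← this]

/-- The scalar products of the coded roots in `s`. -/
def gramRows (s : List ℕ) : List (List ℤ) :=
  s.map fun a => s.map fun b => intDot (rootOf a) (rootOf b)

theorem getD_gramRows {s : List ℕ} (i j : Fin s.length) :
    ((gramRows s).getD i []).getD j 0 = rootOf (s.getD i 0) ⬝ᵥ rootOf (s.getD j 0) := by
  simp [gramRows, intDot_eq]

theorem hasGaugeGroup_of_gramRows {ι : Type} [Fintype ι] [DecidableEq ι]
    {E : Embedding (Fin 8)} {C : Matrix ι ι ℤ} {k u : ℕ} {s : List ℕ} {g : GaugeCase}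
    (σ : ι ≃ Fin k) (hk : (cartanRows g).length = k) (hu : k + u = 8) (hdet : C.det ≠ 0)
    (hC : ∀ i j, (((cartanRows g).getD (σ i) []).getD (σ j) 0 == C i j) = true)
    (hs : gramRows s = (cartanRows g).map fun l => l.map fun x => 4 * x)
    (hmem : ∀ r ∈ s, half (rootOf r) ∈ unbrokenRoots E)
    (hspan : ∀ e ∈ unbrokenRoots E, ∃ c : List ℕ,
      e = half (combination c s) ∨ e = -half (combination c s)) : HasGaugeGroup E C u := by
  have hlen : s.length = k := by
    have := congrArg List.length hs
    rw [List.length_map, hk] at this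
    rw [← this, gramRows, List.length_map]
  subst hlen
  refine hasGaugeGroup_of_simpleRoots σ hu hdet (fun i j => ?_) hmem hspan
  rw [← eq_of_beq (hC i j), ← getD_gramRows, hs]
  -- Mapping commutes with `getD` here because the defaults `[]` and `0` are sent to themselves.
  have h := List.getD_map (l := cartanRows g) (d := []) (n := (σ i : ℕ))
    (fun l => l.map fun x => 4 * x)
  rw [List.map_nil] at h
  rw [h]
  have h := List.getD_map (l := (cartanRows g).getD (σ i) []) (d := 0) (n := (σ j : ℕ))
    (fun x => 4 * x)
  rw [mul_zero] at h
  rw [h]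

/-- The index set of a product of two Cartan matrices, as an initial segment. -/
def sumEquiv {ι κ : Type} {m n : ℕ} (σ : ι ≃ Fin m) (τ : κ ≃ Fin n) : ι ⊕ κ ≃ Fin (m + n) :=
  (Equiv.sumCongr σ τ).trans finSumFinEquiv

theorem det_cartanProd {ι κ : Type} [Fintype ι] [Fintype κ] [DecidableEq ι] [DecidableEq κ]
    (C : Matrix ι ι ℤ) (D : Matrix κ κ ℤ) : (cartanProd C D).det = C.det * D.det :=
  Matrix.det_fromBlocks_zero₂₁ _ _ _

theorem hasCase_of_gramRows {E : Embedding (Fin 8)} {s : List ℕ} {g : GaugeCase}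
    (hs : gramRows s = (cartanRows g).map fun l => l.map fun x => 4 * x)
    (hmem : ∀ r ∈ s, half (rootOf r) ∈ unbrokenRoots E)
    (hspan : ∀ e ∈ unbrokenRoots E, ∃ c : List ℕ,
      e = half (combination c s) ∨ e = -half (combination c s)) : HasCase E g := by
  have h1 : (CartanMatrix.A 1).det ≠ 0 := by decide
  have h2 : (CartanMatrix.A 2).det ≠ 0 := by decide
  have h3 : (CartanMatrix.A 3).det ≠ 0 := by decide
  have h4 : (CartanMatrix.A 4).det ≠ 0 := by decide
  have h5 : (CartanMatrix.D 5).det ≠ 0 := by decide +kernel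
  cases g with
  | case1 =>
    exact hasGaugeGroup_of_gramRows (Equiv.refl (Fin 5)) rfl rfl h5 (by decide) hs hmem hspan
  | case2 =>
    exact hasGaugeGroup_of_gramRows (sumEquiv (Equiv.refl (Fin 4)) (Equiv.refl (Fin 1))) rfl rfl
      (by rw [det_cartanProd]; exact mul_ne_zero h4 h1) (by decide) hs hmem hspan
  | case3 =>
    exact hasGaugeGroup_of_gramRows (sumEquiv (Equiv.refl (Fin 3))
      (sumEquiv (Equiv.refl (Fin 1)) (Equiv.refl (Fin 1)))) rfl rfl
      (by rw [det_cartanProd, det_cartanProd]; exact mul_ne_zero h3 (mul_ne_zero h1 h1))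
      (by decide) hs hmem hspan
  | case4 =>
    exact hasGaugeGroup_of_gramRows (sumEquiv (Equiv.refl (Fin 2))
      (sumEquiv (Equiv.refl (Fin 1)) (Equiv.refl (Fin 1)))) rfl rfl
      (by rw [det_cartanProd, det_cartanProd]; exact mul_ne_zero h2 (mul_ne_zero h1 h1))
      (by decide) hs hmem hspan
  | case5 =>
    exact hasGaugeGroup_of_gramRows (sumEquiv (Equiv.refl (Fin 1)) (Equiv.refl (Fin 1))) rfl rfl
      (by rw [det_cartanProd]; exact mul_ne_zero h1 h1) (by decide) hs hmem hspan

/-! ### Checks on the entries -/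

/-- The three integral vectors of an entry. -/
def Table.integral (t : Table) (r : Entry) : Fin 3 → Fin 8 → ℤ := ![t.twist, r.a1, r.a3]

theorem hidden_dotProduct_half (t : Table) (r : Entry) (p : Fin 3) (y : Fin 8 → ℤ) :
    t.hidden r p ⬝ᵥ half y = ((t.integral r p ⬝ᵥ y : ℤ) : ℝ) / 6 := by
  simp only [Table.hidden, half, dotProduct, Int.cast_sum, Int.cast_mul, Finset.sum_div]
  exact Finset.sum_congr rfl fun i _ => by simp only [Table.integral]; ring

/-- The entries of the extended tables with the simple roots of their gauge groups. -/
def entriesWithRoots : List (Table × Entry × List ℕ) :=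
  [Table.t1, .t2, .t4, .t6, .t8a, .t8b, .t9a, .t9b].flatMap fun t =>
    ((allEntries t).zip (simpleRoots t)).map fun x => (t, x)

theorem exists_mem_entriesWithRoots {t : Table} {r : Entry} (h : r ∈ allEntries t) :
    ∃ s, (t, r, s) ∈ entriesWithRoots := by
  -- `zip` truncates to the shorter list; equal lengths ensure that no entry is lost.
  have hlen : (allEntries t).length = (simpleRoots t).length := by cases t <;> rfl
  obtain ⟨i, hi, rfl⟩ := List.getElem_of_mem h
  refine ⟨(simpleRoots t)[i]'(hlen ▸ hi), ?_⟩
  refine List.mem_flatMap.2 ⟨t, by cases t <;> simp, List.mem_map.2 ⟨_, ?_, rfl⟩⟩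
  rw [List.mem_iff_getElem]
  exact ⟨i, by simp [hi, ← hlen], by simp⟩

/-- The entry is consistent, and the given roots are unbroken and have the Cartan matrix of its
gauge group. -/
def entryCheck (x : Table × Entry × List ℕ) : Bool :=
  let X := x.1.integral x.2.1
  let A := x.1.cmm.triple
  ([0, 1, 2].all fun p =>
    (X p 0 + X p 1 + X p 2 + X p 3 + X p 4 + X p 5 + X p 6 + X p 7) % 2 == 0 &&
    (A p 0 + A p 1 + A p 2 + A p 3 + A p 4 + A p 5 + A p 6 + A p 7) % 2 == 0 &&
    [0, 1, 2].all fun q => (intDot (A p) (A q) + intDot (X p) (X q)) % 3 == 0) &&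
  (x.2.2.all fun r => isRoot r && [0, 1, 2].all fun p => intDot (X p) (rootOf r) % 6 == 0) &&
  gramRows x.2.2 == (cartanRows x.2.1.group).map fun l => l.map fun x => 4 * x

/-- Equality of all coordinates. -/
def sameVector (x y : Fin 8 → ℤ) : Bool :=
  x 0 == y 0 && x 1 == y 1 && x 2 == y 2 && x 3 == y 3 && x 4 == y 4 && x 5 == y 5 &&
    x 6 == y 6 && x 7 == y 7

theorem eq_of_sameVector {x y : Fin 8 → ℤ} (h : sameVector x y = true) : x = y := by
  simp only [sameVector, Bool.and_eq_true, beq_iff_eq] at h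
  ext i
  fin_cases i <;> simp_all

/-- If the coded root is unbroken, it is a combination of the given roots. -/
def spanCheck (n : ℕ) (x : Table × Entry × List ℕ) : Bool :=
  !(Nat.beq (dotCode x.1.twistCode n) 0) || !(Nat.beq (dotCode (classCode x.2.1.a1) n) 0) ||
    !(Nat.beq (dotCode (classCode x.2.1.a3) n) 0) ||
    (positiveRoots x.2.1.group).any fun c =>
      sameVector (combination c x.2.2) (rootOf n) ||
        sameVector (combination c x.2.2) fun i => -rootOf n i

set_option maxHeartbeats 2000000 in
theorem entryCheck_entriesWithRoots : entriesWithRoots.all entryCheck = true := by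
  decide +kernel

-- Every root has a code of weight 2 or 8, so the cheap weight test may discard all other codes
-- before `isRoot` is evaluated.
set_option maxHeartbeats 2000000 in
theorem spanCheck_entriesWithRoots :
    ((List.range 6561).all fun n => !(Nat.beq (weight n) 2 || Nat.beq (weight n) 8) ||
      !isRoot n || entriesWithRoots.all (spanCheck n)) = true := by
  decide +kernel

theorem hidden_apply (t : Table) (r : Entry) (p : Fin 3) (i : Fin 8) :
    t.hidden r p i = (t.integral r p i : ℝ) / 3 := rfl

/-- The 6 combines the denominator 3 of the embedding with the 2 of the doubled root. -/
theorem mem_unbrokenRoots_hidden_iff {t : Table} {r : Entry} {y : Fin 8 → ℤ} :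
    half y ∈ unbrokenRoots (t.hidden r) ↔ half y ∈ e8Roots ∧ ∀ p, 6 ∣ t.integral r p ⬝ᵥ y := by
  refine and_congr_right fun _ => forall_congr' fun p => ?_
  rw [hidden_dotProduct_half]
  constructor
  · rintro ⟨k, hk⟩
    refine ⟨k, ?_⟩
    have : ((t.integral r p ⬝ᵥ y : ℤ) : ℝ) = ((6 * k : ℤ) : ℝ) := by push_cast; linarith
    exact_mod_cast this
  · rintro ⟨k, hk⟩
    exact ⟨k, by rw [hk]; push_cast; ring⟩

theorem forall_fin_three {P : Fin 3 → Prop} (h : ∀ p ∈ ([0, 1, 2] : List (Fin 3)), P p) (p) :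
    P p := by
  fin_cases p <;> exact h _ (by simp)

theorem mem_e8Lattice_of_even {x : Fin 8 → ℤ}
    (h : ((x 0 + x 1 + x 2 + x 3 + x 4 + x 5 + x 6 + x 7) % 2 == 0) = true) :
    (fun i => (x i : ℝ)) ∈ e8Lattice := by
  refine ⟨x, ?_, Or.inl fun _ => rfl⟩
  rw [Fin.sum_univ_eight, Int.even_iff]
  exact eq_of_beq h

theorem isCompletedBy_hidden {t : Table} {r : Entry} (h : r ∈ allEntries t) :
    t.cmm.IsCompletedBy (t.hidden r) := by
  obtain ⟨s, hs⟩ := exists_mem_entriesWithRoots h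
  have hc := List.all_eq_true.1 entryCheck_entriesWithRoots _ hs
  simp only [entryCheck, Bool.and_eq_true] at hc
  have hc := forall_fin_three (List.all_eq_true.1 hc.1.1)
  simp only [Bool.and_eq_true] at hc
  refine ⟨fun p => ⟨?_, ?_⟩, fun p q => ?_⟩
  · convert mem_e8Lattice_of_even (hc p).1.2 using 1
    ext i
    simp only [Pi.smul_apply, Embedding.join, Sum.elim_inl, CMM.observable, smul_eq_mul]
    ring
  · convert mem_e8Lattice_of_even (hc p).1.1 using 1
    ext i
    simp only [Pi.smul_apply, Embedding.join, Sum.elim_inr, hidden_apply, smul_eq_mul]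
    ring
  · have h3 := eq_of_beq (forall_fin_three (List.all_eq_true.1 (hc p).2) q)
    rw [intDot_eq, intDot_eq] at h3
    obtain ⟨k, hk⟩ := Int.dvd_of_emod_eq_zero h3
    refine ⟨k, ?_⟩
    have hk' := congrArg (Int.cast (R := ℝ)) hk
    have : t.cmm.observable.join (t.hidden r) p ⬝ᵥ t.cmm.observable.join (t.hidden r) q =
        ((t.cmm.triple p ⬝ᵥ t.cmm.triple q + t.integral r p ⬝ᵥ t.integral r q : ℤ) : ℝ) / 9 := by
      simp only [dotProduct, Fintype.sum_sum_type, Embedding.join, Sum.elim_inl, Sum.elim_inr,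
        CMM.observable, hidden_apply, Int.cast_add, Int.cast_sum, Int.cast_mul, add_div,
        Finset.sum_div]
      congr 1 <;> exact Finset.sum_congr rfl fun i _ => by ring
    rw [this, hk']; push_cast; ring

/-- For spanning, only the consequence modulo three of being unbroken is used; this lets the test
run on codes. -/
theorem dotCode_eq_zero {x y : Fin 8 → ℤ} (h : 6 ∣ x ⬝ᵥ y) :
    Nat.beq (dotCode (classCode x) (code (red y))) 0 = true := by
  obtain ⟨k, hk⟩ := h
  rw [Nat.beq_eq, show (0 : ℕ) = 0 % 3 from rfl, dotCode_eq_iff, vec_classCode, vec_code,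
    red_dotProduct, smul_dotProduct, hk, nsmul_eq_mul]
  push_cast
  rw [show (2 * (6 * (k : ZMod 3))) = 12 * k by ring, show (12 : ZMod 3) = 0 from rfl, zero_mul]

theorem hasCase_hidden {t : Table} {r : Entry} (h : r ∈ allEntries t) :
    HasCase (t.hidden r) r.group := by
  obtain ⟨s, hs⟩ := exists_mem_entriesWithRoots h
  have hc := List.all_eq_true.1 entryCheck_entriesWithRoots _ hs
  simp only [entryCheck, Bool.and_eq_true] at hc
  obtain ⟨⟨-, hroots⟩, hgram⟩ := hc
  refine hasCase_of_gramRows (eq_of_beq hgram) (fun a ha => ?_) fun e he => ?_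
  · have := List.all_eq_true.1 hroots a ha
    rw [Bool.and_eq_true] at this
    refine mem_unbrokenRoots_hidden_iff.2
      ⟨mem_e8Roots_iff.2 ⟨_, isDoubledRoot_rootOf this.1, rfl⟩, ?_⟩
    refine forall_fin_three fun p hp => Int.dvd_of_emod_eq_zero ?_
    rw [← intDot_eq]
    exact eq_of_beq (List.all_eq_true.1 this.2 p hp)
  · obtain ⟨y, hy, rfl⟩ := mem_e8Roots_iff.1 he.1
    have h6 := (mem_unbrokenRoots_hidden_iff.1 he).2
    obtain ⟨hroot, hw⟩ := hy.rootOf_code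
    have hall := List.all_eq_true.1 spanCheck_entriesWithRoots (code (red y))
      (List.mem_range.2 (code_lt _))
    have hwt : (Nat.beq (weight (code (red y))) 2 || Nat.beq (weight (code (red y))) 8) = true := by
      rcases hw with hw | hw <;> rw [hw] <;> rfl
    have hr : isRoot (code (red y)) = true := by
      rw [isRoot, hroot]; exact decide_eq_true hy
    rw [hwt, hr, Bool.not_true, Bool.false_or, Bool.false_or] at hall
    have hspan := List.all_eq_true.1 hall _ hs
    have h0 : Nat.beq (dotCode t.twistCode (code (red y))) 0 = true := dotCode_eq_zero (h6 0)
    have h1 : Nat.beq (dotCode (classCode r.a1) (code (red y))) 0 = true := dotCode_eq_zero (h6 1)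
    have h2 : Nat.beq (dotCode (classCode r.a3) (code (red y))) 0 = true := dotCode_eq_zero (h6 2)
    rw [spanCheck, h0, h1, h2] at hspan
    simp only [Bool.not_true, Bool.false_or, List.any_eq_true, Bool.or_eq_true] at hspan
    obtain ⟨c, -, hc⟩ := hspan
    rw [hroot] at hc
    refine ⟨c, hc.imp (fun h => ?_) fun h => ?_⟩
    · rw [eq_of_sameVector h]
    · rw [eq_of_sameVector h]
      ext i
      simp only [half, Pi.neg_apply, Int.cast_neg]
      ring

/-! ### Completeness -/

theorem gram_lt (m : CMM) (p q : Fin 3) : m.gram p q < 3 := by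
  unfold CMM.gram; omega

theorem gram_cast (m : CMM) (p q : Fin 3) :
    (m.gram p q : ZMod 3) = -((m.triple p ⬝ᵥ m.triple q : ℤ) : ZMod 3) := by
  have h : ((m.gram p q : ℤ) : ZMod 3) =
      ((-intDot (m.triple p) (m.triple q) % 3 : ℤ) : ZMod 3) := by
    rw [CMM.gram, Int.toNat_of_nonneg (Int.emod_nonneg _ (by norm_num))]
  rw [Int.cast_natCast] at h
  rw [h, (ZMod.intCast_eq_intCast_iff' (-intDot (m.triple p) (m.triple q) % 3)
    (-intDot (m.triple p) (m.triple q)) 3).2 (Int.emod_emod_of_dvd _ dvd_rfl), intDot_eq]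
  push_cast; rfl

/-- With A the observable vectors multiplied by three, integrality of 3(A·A'/9 + y·y'/36) gives y·y'
= 12k - 4 A·A', which is -A·A' modulo three. -/
theorem exists_doubled_of_isCompletedBy {m : CMM} {B : Embedding (Fin 8)}
    (h : m.IsCompletedBy B) :
    ∃ y : Fin 3 → Fin 8 → ℤ, (∀ p, IsDoubled (y p)) ∧ B = ofDoubled y ∧
      ∀ p q, red (y p) ⬝ᵥ red (y q) = (m.gram p q : ZMod 3) := by
  have hy := fun p => mem_e8Lattice_iff.1 (h.1 p).2
  choose y hy hB using hy
  have hB' : B = ofDoubled y := by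
    ext p i
    have := congrFun (hB p) i
    simp only [Pi.smul_apply, Embedding.join, Sum.elim_inr, smul_eq_mul, half] at this
    simp only [ofDoubled]
    linarith
  refine ⟨y, hy, hB', fun p q => ?_⟩
  obtain ⟨k, hk⟩ := h.2 p q
  have e : m.observable.join B p ⬝ᵥ m.observable.join B q =
      ((m.triple p ⬝ᵥ m.triple q : ℤ) : ℝ) / 9 + ((y p ⬝ᵥ y q : ℤ) : ℝ) / 36 := by
    simp only [dotProduct, Fintype.sum_sum_type, Embedding.join, Sum.elim_inl, Sum.elim_inr,
      CMM.observable, hB', ofDoubled, Int.cast_sum, Int.cast_mul, Finset.sum_div]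
    congr 1 <;> exact Finset.sum_congr rfl fun i _ => by ring
  rw [e] at hk
  have hk' : y p ⬝ᵥ y q = 12 * k - 4 * (m.triple p ⬝ᵥ m.triple q) := by
    have : ((y p ⬝ᵥ y q : ℤ) : ℝ) = ((12 * k - 4 * (m.triple p ⬝ᵥ m.triple q) : ℤ) : ℝ) := by
      push_cast at hk ⊢; linarith
    exact_mod_cast this
  rw [red_dotProduct, hk', gram_cast]
  push_cast
  rw [show (12 : ZMod 3) = 0 from rfl, show (4 : ZMod 3) = 1 from rfl]
  ring

theorem vec_zero : vec 0 = 0 := by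
  ext i; simp [vec]

theorem exists_word_twist (m : CMM) {v : Fin 3 → Fin 8 → ZMod 3}
    (hv : ∀ p q, v p ⬝ᵥ v q = (m.gram p q : ZMod 3)) :
    ∃ t ∈ m.tables, ∃ w, IsWord w ∧ act w (v 0) = vec t.twistCode := by
  have key : ∃ w, IsWord w ∧ ((∃ t ∈ m.tables, act w (v 0) = vec t.twistCode) ∨
      act w (v 0) = 0) := by
    have h0 := hv 0 0
    have zero : m.gram 0 0 = 0 → (∀ r ∈ [Table.t1.twistCode, 0],
        (∃ t ∈ m.tables, r = t.twistCode) ∨ r = 0) →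
        ∃ w, IsWord w ∧ ((∃ t ∈ m.tables, act w (v 0) = vec t.twistCode) ∨
          act w (v 0) = 0) := fun hm hr => by
      rw [hm] at h0
      obtain ⟨w, hw, -, -, r, hrm, e⟩ := exists_word_of_orbitCheck orbitCheck_norm_zero
        (by norm_num) (by norm_num) (by norm_num) h0 (by simp [vec_zero]) (by simp [vec_zero])
      refine ⟨w, hw, (hr r hrm).imp ?_ fun h => ?_⟩
      · rintro ⟨t, ht, rfl⟩
        exact ⟨t, ht, e⟩
      · rw [e, h, vec_zero]
    have two : m.gram 0 0 = 2 → (∀ r ∈ [Table.t8a.twistCode, Table.t8b.twistCode],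
        (∃ t ∈ m.tables, r = t.twistCode) ∨ r = 0) →
        ∃ w, IsWord w ∧ ((∃ t ∈ m.tables, act w (v 0) = vec t.twistCode) ∨
          act w (v 0) = 0) := fun hm hr => by
      rw [hm] at h0
      obtain ⟨w, hw, -, -, r, hrm, e⟩ := exists_word_of_orbitCheck orbitCheck_norm_two
        (by norm_num) (by norm_num) (by norm_num) h0 (by simp [vec_zero]) (by simp [vec_zero])
      refine ⟨w, hw, (hr r hrm).imp ?_ fun h => ?_⟩
      · rintro ⟨t, ht, rfl⟩
        exact ⟨t, ht, e⟩
      · rw [e, h, vec_zero]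
    cases m
    · exact zero (by decide) (by simp [CMM.tables])
    · exact zero (by decide) (by simp [CMM.tables, Table.twistCode, Table.twist])
    · exact zero (by decide) (by simp [CMM.tables, Table.twistCode, Table.twist])
    · exact zero (by decide) (by simp [CMM.tables, Table.twistCode, Table.twist])
    · exact two (by decide) (by simp [CMM.tables])
    · exact two (by decide) (by simp [CMM.tables, Table.twistCode, Table.twist])
  obtain ⟨w, hw, ⟨t, ht, h⟩ | h⟩ := key
  · exact ⟨t, ht, w, hw, h⟩
  -- A vanishing twist class would make its norm and its product with the first Wilson line zero;
  -- for each CMM embedding one of the prescribed values is nonzero.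
  · exfalso
    have h0 := hw.act_dotProduct (v 0) (v 0)
    have h1 := hw.act_dotProduct (v 0) (v 1)
    rw [h, zero_dotProduct, hv] at h0 h1
    revert h0 h1
    cases m <;> decide

/-- Three words are concatenated. Each later word fixes the vectors already normalized, and
invariance of the scalar product transports the Gram conditions to the next stage. -/
theorem exists_word_entry {m : CMM} {v : Fin 3 → Fin 8 → ZMod 3}
    (hv : ∀ p q, v p ⬝ᵥ v q = (m.gram p q : ZMod 3)) :
    ∃ t : Table, t.cmm = m ∧ ∃ r ∈ allEntries t, ∃ w, IsWord w ∧
      ∀ p, act w (v p) = red (2 • t.integral r p) := by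
  obtain ⟨t, ht, w₀, hw₀, e₀⟩ := exists_word_twist m hv
  have hm := CMM.cmm_of_mem_tables ht
  subst hm
  have hA := orbitCheck_wilsonLine t
  have hB := orbitCheck_secondLine t
  simp only [force_eq] at hA hB
  have d01 : act w₀ (v 1) ⬝ᵥ vec t.twistCode = (t.cmm.gram 0 1 : ZMod 3) := by
    rw [← e₀, hw₀.act_dotProduct, dotProduct_comm, hv]
  obtain ⟨w₁, hw₁, f₁, -, a, ha, e₁⟩ := exists_word_of_orbitCheck hA (gram_lt _ _ _)
    (gram_lt _ _ _) (gram_lt _ _ _) (u := act w₀ (v 1)) (by rw [hw₀.act_dotProduct, hv]) d01 d01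
  obtain ⟨⟨a, gens⟩, hmem, rfl⟩ := List.mem_map.1 ha
  obtain ⟨w₂, hw₂, f₂, f₂', b, hb, e₂⟩ := exists_word_of_orbitCheck (List.all_eq_true.1 hB _ hmem)
    (gram_lt _ _ _) (gram_lt _ _ _) (gram_lt _ _ _) (u := act w₁ (act w₀ (v 2)))
    (by rw [hw₁.act_dotProduct, hw₀.act_dotProduct, hv])
    (by rw [← f₁, ← e₀, hw₁.act_dotProduct, hw₀.act_dotProduct, dotProduct_comm, hv])
    (by rw [← e₁, hw₁.act_dotProduct, hw₀.act_dotProduct, dotProduct_comm, hv])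
  obtain ⟨r, hr, rfl⟩ := List.mem_map.1 hb
  obtain ⟨hr, hra⟩ := List.mem_filter.1 hr
  have hra : classCode r.a1 = a := eq_of_beq hra
  refine ⟨t, rfl, r, hr, w₀ ++ w₁ ++ w₂, (hw₀.append hw₁).append hw₂, fun p => ?_⟩
  rw [act_append, act_append]
  fin_cases p
  · exact (congrArg _ (congrArg _ e₀)).trans ((congrArg _ f₁).trans (f₂.trans (vec_classCode _)))
  · exact (congrArg _ e₁).trans (f₂'.trans (hra ▸ vec_classCode _))
  · exact e₂.trans (vec_classCode _)

theorem isDoubled_two_smul_integral {t : Table} {r : Entry} (h : r ∈ allEntries t) (p : Fin 3) :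
    IsDoubled (2 • t.integral r p) := by
  have := (isCompletedBy_hidden h).1 p
  obtain ⟨y, hy, e⟩ := mem_e8Lattice_iff.1 this.2
  have : 2 • t.integral r p = y := by
    ext i
    have := congrFun e i
    simp only [Pi.smul_apply, Embedding.join, Sum.elim_inr, smul_eq_mul, half, hidden_apply] at this
    have : ((2 * t.integral r p i : ℤ) : ℝ) = y i := by push_cast; linarith
    rw [Pi.smul_apply, nsmul_eq_mul]
    exact_mod_cast this
  rwa [this]

theorem exists_equivalent_entry {m : CMM} {B : Embedding (Fin 8)} (h : m.IsCompletedBy B) :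
    ∃ t : Table, t.cmm = m ∧ ∃ r ∈ allEntries t, Equivalent B (t.hidden r) := by
  obtain ⟨y, hy, rfl, hgram⟩ := exists_doubled_of_isCompletedBy h
  obtain ⟨t, ht, r, hr, w, hw, e⟩ := exists_word_entry hgram
  obtain ⟨z, hz, hyz, e'⟩ := hw.exists_equivalent hy
  refine ⟨t, ht, r, hr, hyz.trans ?_⟩
  have : t.hidden r = ofDoubled fun p => 2 • t.integral r p := by
    ext p i
    rw [hidden_apply, ofDoubled, Pi.smul_apply, nsmul_eq_mul]
    push_cast; ring
  rw [this]
  exact equivalent_of_red_eq hz (isDoubled_two_smul_integral hr) fun p => by rw [e', e]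

/-! ### The tables -/

theorem nodup_map_hidden (t : Table) : ((allEntries t).map t.hidden).Nodup := by
  -- Entries are already distinct modulo three, which is stronger and decidable on codes.
  have h : ((allEntries t).map fun r => (classCode r.a1, classCode r.a3)).Nodup := by
    cases t <;> decide +kernel
  rw [List.Nodup, List.pairwise_map] at h ⊢
  refine h.imp fun {r s} hne heq => hne ?_
  have hp : ∀ p, t.integral r p = t.integral s p := fun p => by
    ext i
    have := congrFun (congrFun heq p) i
    rw [hidden_apply, hidden_apply, div_left_inj' (by norm_num)] at this
    exact_mod_cast this
  exact Prod.ext (congrArg classCode (hp 1)) (congrArg classCode (hp 2))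

end HiddenSector

/-! ### Assembly of the classification -/

theorem mainTheorem1 :
    -- the displayed tables: 175 distinct entries, all consistent, with the stated gauge groups
    (∑ t : HiddenSector.Table, t.entries.length = 175 ∧
      ∀ t : HiddenSector.Table, (t.entries.map t.hidden).Nodup ∧
        ∀ r ∈ t.entries, r.group ≠ HiddenSector.GaugeCase.case5 ∧
          t.cmm.IsCompletedBy (t.hidden r) ∧ HiddenSector.HasCase (t.hidden r) r.group) ∧
    -- the displayed tables are complete up to embeddings with gauge group Case 5
    (∀ (m : HiddenSector.CMM) (B : HiddenSector.Embedding (Fin 8)), m.IsCompletedBy B →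
      ¬ HiddenSector.HasCase B HiddenSector.GaugeCase.case5 →
        ∃ t : HiddenSector.Table, t.cmm = m ∧
          ∃ r ∈ t.entries, HiddenSector.Equivalent B (t.hidden r)) ∧
    -- adding 17 entries of Case 5 to the tables gives a complete list of 192 entries
    ∃ extra : HiddenSector.Table → List HiddenSector.Entry,
      (∑ t : HiddenSector.Table, (extra t).length = 17 ∧
        ∑ t : HiddenSector.Table, (t.entries ++ extra t).length = 192 ∧
        ∀ t : HiddenSector.Table, ((t.entries ++ extra t).map t.hidden).Nodup ∧
          ∀ r ∈ extra t, r.group = HiddenSector.GaugeCase.case5 ∧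
            t.cmm.IsCompletedBy (t.hidden r) ∧ HiddenSector.HasCase (t.hidden r) r.group) ∧
      ∀ (m : HiddenSector.CMM) (B : HiddenSector.Embedding (Fin 8)), m.IsCompletedBy B →
        ∃ t : HiddenSector.Table, t.cmm = m ∧
          ∃ r ∈ t.entries ++ extra t, HiddenSector.Equivalent B (t.hidden r) := by
  have hleft : ∀ (t : HiddenSector.Table), ∀ r ∈ t.entries, r ∈ HiddenSector.allEntries t :=
    fun t r hr => List.mem_append_left _ hr
  have hright : ∀ (t : HiddenSector.Table), ∀ r ∈ HiddenSector.extraEntries t,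
    r ∈ HiddenSector.allEntries t := fun t r hr => List.mem_append_right _ hr
  have hcase : ∀ (t : HiddenSector.Table), ∀ r ∈ HiddenSector.extraEntries t,
      r.group = HiddenSector.GaugeCase.case5 := by
    intro t
    cases t <;> simp [HiddenSector.extraEntries]
  refine ⟨⟨rfl, fun t => ⟨?_, fun r hr => ⟨?_, HiddenSector.isCompletedBy_hidden (hleft t r hr),
    HiddenSector.hasCase_hidden (hleft t r hr)⟩⟩⟩, fun m B hB h5 => ?_,
    HiddenSector.extraEntries, ⟨rfl, rfl, fun t => ⟨HiddenSector.nodup_map_hidden t, fun r hr =>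
      ⟨hcase t r hr, HiddenSector.isCompletedBy_hidden (hright t r hr),
        HiddenSector.hasCase_hidden (hright t r hr)⟩⟩⟩,
    fun m B hB => HiddenSector.exists_equivalent_entry hB⟩
  · have := HiddenSector.nodup_map_hidden t
    rw [HiddenSector.allEntries, List.map_append] at this
    exact this.of_append_left
  · revert r
    cases t <;> simp [HiddenSector.Table.entries]
  · obtain ⟨t, ht, r, hr, hBr⟩ := HiddenSector.exists_equivalent_entry hB
    refine ⟨t, ht, r, ?_, hBr⟩
    rcases List.mem_append.1 hr with hr | hr
    · exact hr
    -- An added entry would transfer its Case 5 gauge group back to B.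
    · refine absurd (HiddenSector.HasCase.of_equivalent hBr ?_) h5
      rw [← hcase t r hr]
      exact HiddenSector.hasCase_hidden (hright t r hr)
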